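/- **Corollary 2.3 (HLS type inequality on Carnot groups).** Let $G$ be a Carnot group: let $\mathfrak g=V_1\oplus\dots\oplus V_k$ be a real Lie algebra with subspaces $V_l$ of finite dimension $m_l$ such that $[V_1,V_l]=V_{l+1}$ for $1\le l<k$ and $[V_1,V_k]=\{0\}$, and let $G$ be the associated simply connected nilpotent Lie group in exponential coordinates $u=(z_1,\dots,z_k)$, $z_l\in\mathbb R^{m_l}$, given by a basis of each $V_l$; that is, $G=\mathbb R^{m_1}\times\dots\times\mathbb R^{m_k}$ with the group law given by the Baker–Campbell–Hausdorff formula. Let $du$ be a fixed Haar measure on $G$, let $Q=\sum_{l=1}^k l\,m_l$ be the homogeneous dimension, and let $$|u|=\Big(\sum_{j=1}^k |z_j|^{2\cdot k!/j}\Big)^{1/(2\cdot k!)}$$ be the homogeneous norm, where $|z_j|$ is the Euclidean norm of $z_j$. Let $1<r,s<\infty$ and $0<\lambda<Q$ with $\frac1r+\frac1s+\frac\lambda Q=2$. Then there is a constant $C=C_{r,\lambda,G}>0$ such that for all $f\in L^r(G)$ and $g\in L^s(G)$ (complex valued) the double integral below converges absolutely and $$\left|\iint_{G\times G}\frac{\overline{f(u)}\,g(v)}{|u^{-1}v|^{\lambda}}\,du\,dv\right|\le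 C\,\|f\|_r\,\|g\|_s .$$ -/

import Mathlib

namespace Carnot

open Finset Polynomial
open scoped Nat

/-! ## The Baker-Campbell-Hausdorff product -/

/-- The iterated commutator `⁅a₁, ⁅a₂, … ⁅aₖ₋₁, aₖ⁆ … ⁆⁆` of a list; the single element `a₁` if `k = 1`. -/
def nestedBracket {L : Type*} [LieRing L] : List L → L
  | [] => 0
  | [a] => a
  | a :: b :: l => ⁅a, nestedBracket (b :: l)⁆

/-- The word `x … x y … y x … x y … y …` with `p 0` letters `x`, then `q 0` letters `y`,
then `p 1` letters `x`, and so on. -/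
def bchWord {L : Type*} (x y : L) {n : ℕ} (p q : Fin n → ℕ) : List L :=
  (List.ofFn fun i => List.replicate (p i) x ++ List.replicate (q i) y).flatten

/-- The Baker-Campbell-Hausdorff formula (in the explicit form of Dynkin) in a Lie algebra that is
nilpotent of step at most `r`:
`∑ₙ (-1)ⁿ⁻¹/n ∑ [x^p₁ y^q₁ ⋯ x^pₙ y^qₙ] / ((∑ (pᵢ + qᵢ)) ∏ pᵢ! qᵢ!)`, the inner sum over all
`pᵢ, qᵢ ≥ 0` with `pᵢ + qᵢ > 0`. The sums stop at `r`, as the iterated commutators of more than `r`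
elements vanish. -/
noncomputable def bch {L : Type*} [LieRing L] [LieAlgebra ℝ L] (r : ℕ) (x y : L) : L :=
  ∑ n ∈ Finset.Icc 1 r, ∑ p : Fin n → Fin (r + 1), ∑ q : Fin n → Fin (r + 1),
    if ∀ i, 0 < (p i : ℕ) + q i then
      ((-1 : ℝ) ^ (n - 1) / n * (∑ i, ((p i : ℝ) + q i))⁻¹ *
        ∏ i, (((p i)! : ℝ) * (q i)!)⁻¹) •
        nestedBracket (bchWord x y (fun i => p i) (fun i => q i))
    else 0

/-! ## Stratified Lie algebras and Carnot groups -/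

/-- A stratification `L = V₁ ⊕ ⋯ ⊕ Vᵣ` of a real Lie algebra, `Vₗ = layer l` for `1 ≤ l ≤ r`
(the other values of `layer` play no role), with `[V₁, Vₗ] = Vₗ₊₁` for `l < r` and `[V₁, Vᵣ] = 0`,
together with linear coordinates on each layer, that is, a basis of `Vₗ` with `mₗ = dim Vₗ`
elements. The index `l : Fin r` stands for the layer `l + 1`. -/
structure Stratification (L : Type*) [LieRing L] [LieAlgebra ℝ L] (r : ℕ) where
  layer : ℕ → Submodule ℝ L
  isInternal : DirectSum.IsInternal fun l : Fin r => layer (l + 1)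
  lie_layer : ∀ l, 1 ≤ l → l < r →
    Submodule.span ℝ {z | ∃ x ∈ layer 1, ∃ y ∈ layer l, ⁅x, y⁆ = z} = layer (l + 1)
  lie_top : ∀ x ∈ layer 1, ∀ y ∈ layer r, ⁅x, y⁆ = 0
  m : Fin r → ℕ
  basis : ∀ l : Fin r, Module.Basis (Fin (m l)) ℝ (layer (l + 1))

/-- The Carnot group of a stratified Lie algebra in exponential coordinates: its points are
`u = (z₁, …, zᵣ)` with `zₗ ∈ ℝ^mₗ`, and the group law is given below. -/
def CarnotGroup {L : Type*} [LieRing L] [LieAlgebra ℝ L] {r : ℕ} (S : Stratification L r) : Type :=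
  ∀ l : Fin r, EuclideanSpace ℝ (Fin (S.m l))

namespace Stratification
variable {L : Type*} [LieRing L] [LieAlgebra ℝ L] {r : ℕ} (S : Stratification L r)

/-- The basis of the Lie algebra that consists of the bases of the layers. -/
noncomputable def fullBasis : Module.Basis (Σ l : Fin r, Fin (S.m l)) ℝ L :=
  S.isInternal.collectedBasis S.basis

/-- The element of the Lie algebra with the coordinates `u` (the logarithm of `u`). -/
noncomputable def toLie (u : CarnotGroup S) : L := ∑ l, ∑ j, u l j • (S.basis l j : L)

/-- The coordinates of an element of the Lie algebra; the inverse of `toLie`. -/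
noncomputable def ofLie (x : L) : CarnotGroup S :=
  fun l => WithLp.toLp 2 fun j => S.fullBasis.repr x ⟨l, j⟩

theorem toLie_eq (u : CarnotGroup S) :
    S.toLie u = S.fullBasis.equivFun.symm fun i => u i.1 i.2 := by
  rw [Module.Basis.equivFun_symm_apply, Fintype.sum_sigma, toLie]
  simp [fullBasis]

theorem toLie_ofLie (x : L) : S.toLie (S.ofLie x) = x := by
  rw [toLie_eq, LinearEquiv.symm_apply_eq]
  rfl

theorem ofLie_toLie (u : CarnotGroup S) : S.ofLie (S.toLie u) = u := by
  funext l
  ext j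
  change S.fullBasis.equivFun (S.toLie u) ⟨l, j⟩ = u l j
  rw [toLie_eq, LinearEquiv.apply_symm_apply]

/-- The group law in exponential coordinates: the Baker-Campbell-Hausdorff product. -/
noncomputable instance : Mul (CarnotGroup S) := 
  ⟨fun u v => S.ofLie (bch r (S.toLie u) (S.toLie v))⟩
instance : One (CarnotGroup S) := ⟨fun _ => 0⟩
noncomputable instance : Inv (CarnotGroup S) := ⟨fun u l => - u l⟩

theorem mul_def (u v : CarnotGroup S) : u * v = S.ofLie (bch r (S.toLie u) (S.toLie v)) := rfl

theorem toLie_mul (u v : CarnotGroup S) : S.toLie (u * v) = bch r (S.toLie u) (S.toLie v) := by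
  rw [mul_def, toLie_ofLie]

theorem toLie_one : S.toLie 1 = 0 := by
  change ∑ l, ∑ j, (0 : ℝ) • (S.basis l j : L) = 0
  simp

theorem toLie_inv (u : CarnotGroup S) : S.toLie u⁻¹ = - S.toLie u := by
  change ∑ l, ∑ j, (- u l j) • (S.basis l j : L) = _
  simp [toLie]

theorem toLie_injective : Function.Injective S.toLie :=
  Function.LeftInverse.injective S.ofLie_toLie

instance : TopologicalSpace (CarnotGroup S) :=
  inferInstanceAs (TopologicalSpace (∀ l : Fin r, EuclideanSpace ℝ (Fin (S.m l))))
instance : MeasurableSpace (CarnotGroup S) :=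
  inferInstanceAs (MeasurableSpace (∀ l : Fin r, EuclideanSpace ℝ (Fin (S.m l))))
instance : BorelSpace (CarnotGroup S) :=
  inferInstanceAs (BorelSpace (∀ l : Fin r, EuclideanSpace ℝ (Fin (S.m l))))

/-- The homogeneous dimension `Q = ∑ l mₗ`. -/
def homDim : ℕ := ∑ l : Fin r, ((l : ℕ) + 1) * S.m l

/-- The homogeneous norm `|u| = (∑ⱼ |zⱼ| ^ (2 r! / j)) ^ (1 / (2 r!))`, `|zⱼ|` the Euclidean norm. -/
noncomputable def homNorm (u : CarnotGroup S) : ℝ :=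
  (∑ l : Fin r, ‖u l‖ ^ (2 * (r ! : ℝ) / ((l : ℝ) + 1))) ^ (1 / (2 * (r ! : ℝ)))

end Stratification

/-! ## The group axioms

It remains to see that the product above is a group law. The Lie algebra has a faithful
representation by nilpotent endomorphisms, and there `exp (bch x y) = exp x * exp y`. -/

section

attribute [local instance] LieRing.ofAssociativeRing

/-- Truncated exponential series. -/
noncomputable def expN {A : Type*} [Ring A] [Algebra ℝ A] (N : ℕ) (a : A) : A :=
  ∑ k ∈ range N, ((k ! : ℝ)⁻¹) • a ^ k

/-- Truncated series of `log (1 + a)`. -/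
noncomputable def logN {A : Type*} [Ring A] [Algebra ℝ A] (N : ℕ) (a : A) : A :=
  ∑ n ∈ range N, ((-1 : ℝ) ^ n / (n + 1)) • a ^ (n + 1)

theorem map_expN {A B : Type*} [Ring A] [Algebra ℝ A] [Ring B] [Algebra ℝ B] (f : A →ₐ[ℝ] B)
    (N : ℕ) (a : A) : f (expN N a) = expN N (f a) := by
  simp [expN]

theorem map_logN {A B : Type*} [Ring A] [Algebra ℝ A] [Ring B] [Algebra ℝ B] (f : A →ₐ[ℝ] B)
    (N : ℕ) (a : A) : f (logN N a) = logN N (f a) := by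
  simp [logN]

theorem aeval_eq_zero_of_dvd {A : Type*} [Ring A] [Algebra ℝ A] {N : ℕ} {a : A} (ha : a ^ N = 0)
    {p : ℝ[X]} (hp : X ^ N ∣ p) : aeval a p = 0 := by
  obtain ⟨q, rfl⟩ := hp
  simp [ha]

theorem X_pow_dvd_of_derivative {N : ℕ} {p : ℝ[X]} (h0 : p.coeff 0 = 0)
    (h : X ^ N ∣ derivative p) : X ^ (N + 1) ∣ p := by
  rw [X_pow_dvd_iff] at h ⊢
  intro d hd
  rcases d with _ | d
  · exact h0
  · have := h d (by omega)
    rw [coeff_derivative] at this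
    have h2 : ((d : ℝ) + 1) ≠ 0 := by positivity
    exact (mul_eq_zero.1 this).resolve_right h2

theorem derivative_expN (N : ℕ) (l : ℝ[X]) :
    derivative (expN (N + 1) l) = derivative l * expN N l := by
  rw [expN, sum_range_succ', expN, derivative_add, derivative_sum, mul_sum]
  simp only [derivative_smul, derivative_pow, pow_zero, derivative_one, smul_zero, add_zero]
  refine sum_congr rfl fun k _ => ?_
  simp only [smul_eq_C_mul, Nat.factorial_succ, Nat.cast_mul, Nat.add_sub_cancel, mul_inv, map_mul]
  have : C (((k + 1 : ℕ) : ℝ)⁻¹) * C ((k + 1 : ℕ) : ℝ) = 1 := by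
    rw [← C_mul, inv_mul_cancel₀ (by positivity), C_1]
  linear_combination (C ((k ! : ℝ)⁻¹) * l ^ k * derivative l) * this

theorem derivative_logN (N : ℕ) (l : ℝ[X]) :
    derivative (logN N l) = (∑ n ∈ range N, (-l) ^ n) * derivative l := by
  rw [logN, derivative_sum, sum_mul]
  refine sum_congr rfl fun k _ => ?_
  rw [derivative_smul, derivative_pow, smul_eq_C_mul, Nat.add_sub_cancel, neg_pow l]
  have : C ((-1 : ℝ) ^ k / (k + 1)) * C ((k + 1 : ℕ) : ℝ) = (-1) ^ k := by
    rw [← C_mul]; push_cast; rw [div_mul_cancel₀ _ (by positivity)]; simp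
  rw [← this]
  ring_nf

theorem geom_aux (N : ℕ) (l : ℝ[X]) :
    (1 + l) * (∑ n ∈ range N, (-l) ^ n) = 1 - (-l) ^ N := by
  have := mul_neg_geom_sum (-l) N
  rw [sub_neg_eq_add] at this
  exact this

theorem X_dvd_logN (N : ℕ) {l : ℝ[X]} (h : X ∣ l) : X ∣ logN N l :=
  dvd_sum fun n _ => by
    rw [smul_eq_C_mul]
    exact dvd_mul_of_dvd_right (dvd_pow h (Nat.succ_ne_zero n)) _

theorem X_dvd_expN (N : ℕ) {l : ℝ[X]} (h : X ∣ l) : X ∣ expN (N + 1) l - 1 := by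
  rw [expN, sum_range_succ']
  simp only [Nat.factorial_zero, Nat.cast_one, inv_one, pow_zero, one_smul, add_sub_cancel_right]
  exact dvd_sum fun n _ => by
    rw [smul_eq_C_mul]
    exact dvd_mul_of_dvd_right (dvd_pow h (Nat.succ_ne_zero n)) _

theorem logN_expN_poly (N : ℕ) :
    X ^ (N + 1) ∣ logN (N + 1) (expN (N + 1) (X : ℝ[X]) - 1) - X := by
  have hE := X_dvd_expN N (dvd_refl (X : ℝ[X]))
  apply X_pow_dvd_of_derivative
  · rw [← X_dvd_iff]
    exact dvd_sub (X_dvd_logN _ hE) dvd_rfl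
  · set E := expN (N + 1) (X : ℝ[X]) with hEdef
    have hd : derivative E = E - C ((N ! : ℝ)⁻¹) * X ^ N := by
      rw [hEdef, derivative_expN, derivative_X, one_mul]
      conv_rhs => rw [expN, sum_range_succ]
      rw [expN, smul_eq_C_mul]; ring
    have hco : IsCoprime (X ^ N) E := by
      apply IsCoprime.pow_left
      obtain ⟨q, hq⟩ := hE
      exact ⟨-q, 1, by linear_combination hq⟩
    apply hco.dvd_of_dvd_mul_left
    rw [derivative_sub, derivative_logN, derivative_X, derivative_sub, derivative_one, sub_zero]
    have hg := geom_aux (N + 1) (E - 1)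
    have : E * ((∑ n ∈ range (N + 1), (-(E - 1)) ^ n) * derivative E - 1)
        = -(-(E - 1)) ^ (N + 1) * derivative E - C ((N ! : ℝ)⁻¹) * X ^ N := by
      linear_combination (derivative E) * hg + hd
    rw [this]
    refine dvd_sub (dvd_mul_of_dvd_left ?_ _) (dvd_mul_left _ _)
    rw [dvd_neg]
    exact (pow_dvd_pow _ (Nat.le_succ N)).trans (pow_dvd_pow_of_dvd ((dvd_neg).2 hE) _)

theorem expN_logN_poly (N : ℕ) :
    X ^ (N + 1) ∣ expN (N + 1) (logN (N + 1) (X : ℝ[X])) - (1 + X) := by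
  have hl := X_dvd_logN (N + 1) (dvd_refl (X : ℝ[X]))
  set l := logN (N + 1) (X : ℝ[X]) with hldef
  have hE := X_dvd_expN N hl
  have hdl : (1 + X) * derivative l = 1 - (-X) ^ (N + 1) := by
    rw [hldef, derivative_logN, derivative_X, mul_one, geom_aux]
  set E := expN (N + 1) l with hEdef
  have hd : derivative E = derivative l * (E - C ((N ! : ℝ)⁻¹) * l ^ N) := by
    rw [hEdef, derivative_expN]
    conv_rhs => rw [expN, sum_range_succ]
    rw [expN, smul_eq_C_mul]; ring
  set f := E - (1 + X) with hf
  have hdf : derivative f = derivative E - 1 := by rw [hf]; simp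
  have key : X ^ N ∣ derivative f * X + derivative f - f := by
    have : derivative f * X + derivative f - f
      = -(-X) ^ (N + 1) * (E - C ((N ! : ℝ)⁻¹) * l ^ N) - C ((N ! : ℝ)⁻¹) * l ^ N := by
      rw [hdf, hf]
      linear_combination (1 + X) * hd + (E - C ((N ! : ℝ)⁻¹) * l ^ N) * hdl
    rw [this]
    refine dvd_sub (dvd_mul_of_dvd_left ?_ _) (dvd_mul_of_dvd_right (pow_dvd_pow_of_dvd hl _) _)
    rw [dvd_neg]
    exact (pow_dvd_pow _ (Nat.le_succ N)).trans (pow_dvd_pow_of_dvd ((dvd_neg).2 dvd_rfl) _)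
  rw [X_pow_dvd_iff] at key ⊢
  intro d
  induction d with
  | zero =>
    intro _
    rw [← X_dvd_iff]
    have : f = (E - 1) - X := by rw [hf]; ring
    rw [this]; exact dvd_sub hE dvd_rfl
  | succ d ih =>
    intro hd'
    have h1 := key d (by omega)
    have h2 := ih (by omega)
    have h3 : (derivative f * X).coeff d = 0 := by
      rcases d with _ | d
      · simp
      · rw [coeff_mul_X, coeff_derivative, h2, zero_mul]
    rw [coeff_sub, coeff_add, h3, h2, coeff_derivative, zero_add, sub_zero] at h1
    have h4 : ((d : ℝ) + 1) ≠ 0 := by positivity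
    exact (mul_eq_zero.1 h1).resolve_right h4

theorem logN_expN {A : Type*} [Ring A] [Algebra ℝ A] {N : ℕ} {a : A} (ha : a ^ (N + 1) = 0) :
    logN (N + 1) (expN (N + 1) a - 1) = a := by
  have := aeval_eq_zero_of_dvd ha (logN_expN_poly N)
  rw [map_sub, map_logN, map_sub, map_expN, aeval_X, map_one, sub_eq_zero] at this
  exact this

theorem expN_logN {A : Type*} [Ring A] [Algebra ℝ A] {N : ℕ} {a : A} (ha : a ^ (N + 1) = 0) :
    expN (N + 1) (logN (N + 1) a) = 1 + a := by
  have := aeval_eq_zero_of_dvd ha (expN_logN_poly N)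
  rw [map_sub, map_expN, map_logN, map_add, aeval_X, map_one, sub_eq_zero] at this
  exact this

theorem expN_eq_exp {A : Type*} [Ring A] [Algebra ℝ A] {N : ℕ} {a : A} (ha : a ^ N = 0) :
    letI : Module ℚ A := Module.compHom A (algebraMap ℚ ℝ)
    expN N a = IsNilpotent.exp a := by
  let _ : Module ℚ A := Module.compHom A (algebraMap ℚ ℝ)
  rw [IsNilpotent.exp_eq_sum ha, expN]
  refine sum_congr rfl fun k _ => ?_
  change _ = (algebraMap ℚ ℝ ((k ! : ℚ)⁻¹)) • a ^ k
  simp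

theorem expN_mul_neg {A : Type*} [Ring A] [Algebra ℝ A] {N : ℕ} {a : A} (ha : a ^ N = 0) :
    expN N a * expN N (-a) = 1 := by
  let _ : Module ℚ A := Module.compHom A (algebraMap ℚ ℝ)
  rw [expN_eq_exp ha, expN_eq_exp (by rw [neg_pow, ha, mul_zero])]
  exact IsNilpotent.exp_mul_exp_neg_self ⟨N, ha⟩

theorem ad_pow_eq_zero {A : Type*} [Ring A] [Algebra ℝ A] {N : ℕ} {a : A} (ha : a ^ N = 0) :
    (LieAlgebra.ad ℝ A a) ^ (2 * N) = 0 := by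
  rcases N with _ | N
  · have : Subsingleton A := by
      rw [pow_zero] at ha
      exact subsingleton_of_zero_eq_one ha.symm
    exact Subsingleton.elim _ _
  rw [LieAlgebra.ad_eq_lmul_left_sub_lmul_right, Pi.sub_apply, sub_eq_add_neg]
  refine Commute.add_pow_eq_zero_of_add_le_succ_of_pow_eq_zero (m := N + 1) (n := N + 1) ?_ ?_ ?_ (by omega)
  · exact (LinearMap.commute_mulLeft_right (R := ℝ) a a).neg_right
  · rw [LinearMap.pow_mulLeft, ha, LinearMap.mulLeft_zero_eq_zero]
  · rw [neg_pow, LinearMap.pow_mulRight, ha, LinearMap.mulRight_zero_eq_zero, mul_zero]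

theorem expN_ad {A : Type*} [Ring A] [Algebra ℝ A] {N : ℕ} {a : A} (ha : a ^ N = 0) (c : A) :
    expN (2 * N) (LieAlgebra.ad ℝ A a) c = expN N a * c * expN N (-a) := by
  have hl : (LinearMap.mulLeft ℝ a) ^ N = 0 := by
    rw [LinearMap.pow_mulLeft, ha, LinearMap.mulLeft_zero_eq_zero]
  have hr : (LinearMap.mulRight ℝ (-a)) ^ N = 0 := by
    rw [LinearMap.pow_mulRight, neg_pow, ha, mul_zero, LinearMap.mulRight_zero_eq_zero]
  have e : LieAlgebra.ad ℝ A a = LinearMap.mulLeft ℝ a + LinearMap.mulRight ℝ (-a) := by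
    ext x; simp [LieRing.of_associative_ring_bracket, sub_eq_add_neg]
  have h : expN (2 * N) (LieAlgebra.ad ℝ A a)
      = expN N (LinearMap.mulLeft ℝ a) * expN N (LinearMap.mulRight ℝ (-a)) := by
    let _ : Module ℚ (Module.End ℝ A) := Module.compHom _ (algebraMap ℚ ℝ)
    rw [expN_eq_exp (ad_pow_eq_zero ha), expN_eq_exp hl, expN_eq_exp hr, e]
    exact IsNilpotent.exp_add_of_commute (LinearMap.commute_mulLeft_right (R := ℝ) a (-a))
      ⟨N, hl⟩ ⟨N, hr⟩
  rw [h, Module.End.mul_apply, mul_assoc]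
  simp only [expN, LinearMap.sum_apply, LinearMap.smul_apply, LinearMap.pow_mulLeft,
    LinearMap.pow_mulRight, LinearMap.mulLeft_apply, LinearMap.mulRight_apply, sum_mul, mul_sum,
    smul_mul_assoc, mul_smul_comm, smul_sum]
  rw [sum_comm]
  exact sum_congr rfl fun i _ => sum_congr rfl fun j _ => smul_comm _ _ _


def opFold {L : Type*} [LieRing L] (l : List L) (c : L) : L := l.foldr (fun a b => ⁅a, b⁆) c

theorem nested_eq {L : Type*} [LieRing L] (D : L) (l : List L) (hl : ∀ a ∈ l, ⁅a, D⁆ = -a)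
    (h : l ≠ []) : nestedBracket l = - opFold l D := by
  induction l with
  | nil => exact absurd rfl h
  | cons a l ih =>
    rcases l with _ | ⟨b, l⟩
    · simp [nestedBracket, opFold, hl a]
    · rw [nestedBracket, ih (fun c hc => hl c (List.mem_cons_of_mem _ hc)) (by simp), lie_neg]
      rfl

theorem D_nested {L : Type*} [LieRing L] [LieAlgebra ℝ L] (D : L) (l : List L)
    (hl : ∀ a ∈ l, ⁅D, a⁆ = a) : ⁅D, nestedBracket l⁆ = (l.length : ℝ) • nestedBracket l := by
  induction l with
  | nil => simp [nestedBracket]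
  | cons a l ih =>
    rcases l with _ | ⟨b, l⟩
    · simp [nestedBracket, hl a]
    · rw [nestedBracket, leibniz_lie, ih (fun c hc => hl c (List.mem_cons_of_mem _ hc)),
        hl a (by simp), lie_smul, List.length_cons (a := a)]
      push_cast
      rw [add_smul _ (1 : ℝ), one_smul, add_comm]

theorem opFold_replicate {L : Type*} [LieRing L] [LieAlgebra ℝ L] (x c : L) (k : ℕ) :
    opFold (List.replicate k x) c = (LieAlgebra.ad ℝ L x ^ k) c := by
  induction k with
  | zero => simp [opFold]
  | succ k ih =>
    rw [List.replicate_succ, pow_succ', Module.End.mul_apply, ← ih]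
    simp [opFold]

theorem opFold_append {L : Type*} [LieRing L] (l l' : List L) (c : L) :
    opFold (l ++ l') c = opFold l (opFold l' c) := by simp [opFold]

theorem mem_bchWord {L : Type*} {x y : L} {n : ℕ} {p q : Fin n → ℕ} {a : L}
    (h : a ∈ bchWord x y p q) : a = x ∨ a = y := by
  simp only [bchWord, List.mem_flatten, List.mem_ofFn] at h
  obtain ⟨l, ⟨i, rfl⟩, h⟩ := h
  rw [List.mem_append] at h
  exact h.imp List.eq_of_mem_replicate List.eq_of_mem_replicate

theorem length_bchWord {L : Type*} (x y : L) {n : ℕ} (p q : Fin n → ℕ) :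
    (bchWord x y p q).length = ∑ i, (p i + q i) := by
  simp [bchWord, List.length_flatten, List.map_ofFn, List.sum_ofFn, Function.comp_def]

theorem expN_mul_sub_one {V : Type*} [AddCommGroup V] [Module ℝ V] (r : ℕ) (S T : Module.End ℝ V)
    (v : V) : (expN (r + 1) S * expN (r + 1) T - 1) v =
      ∑ a : Fin (r + 1) × Fin (r + 1), if 0 < (a.1 : ℕ) + a.2 then
        (((a.1)! : ℝ) * (a.2)!)⁻¹ • (S ^ (a.1 : ℕ)) ((T ^ (a.2 : ℕ)) v) else 0 := by
  have h : (expN (r + 1) S * expN (r + 1) T) v =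
      ∑ a : Fin (r + 1) × Fin (r + 1),
        (((a.1)! : ℝ) * (a.2)!)⁻¹ • (S ^ (a.1 : ℕ)) ((T ^ (a.2 : ℕ)) v) := by
    rw [Fintype.sum_prod_type, Module.End.mul_apply, expN, expN, ← Fin.sum_univ_eq_sum_range
      (fun k => ((k ! : ℝ)⁻¹) • S ^ k), ← Fin.sum_univ_eq_sum_range (fun k => ((k ! : ℝ)⁻¹) • T ^ k)]
    simp only [LinearMap.sum_apply, LinearMap.smul_apply, map_sum, map_smul, smul_sum, smul_smul,
      mul_inv]
    rw [sum_comm]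
    exact sum_congr rfl fun i _ => sum_congr rfl fun j _ => by rw [mul_comm]
  rw [LinearMap.sub_apply, h, ← add_sum_erase _ _ (mem_univ (0, 0)), Module.End.one_apply,
    ← add_sum_erase univ (fun a : Fin (r + 1) × Fin (r + 1) => if 0 < (a.1 : ℕ) + a.2 then
        (((a.1)! : ℝ) * (a.2)!)⁻¹ • (S ^ (a.1 : ℕ)) ((T ^ (a.2 : ℕ)) v) else 0) (mem_univ (0, 0))]
  simp only [Fin.val_zero, add_zero, lt_irrefl, if_false, zero_add, Nat.factorial_zero, pow_zero,
    Nat.cast_one, mul_one, inv_one, one_smul, Module.End.one_apply, add_sub_cancel_left]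
  refine sum_congr rfl fun a ha => ?_
  rw [if_pos]
  rw [mem_erase] at ha
  by_contra h0
  apply ha.1
  ext
  · simp only [Fin.val_zero]; omega
  · simp only [Fin.val_zero]; omega

theorem sum_words_aux {L : Type*} [LieRing L] [LieAlgebra ℝ L] (r : ℕ) (x y c : L) (n : ℕ) :
    ∑ w : Fin n → Fin (r + 1) × Fin (r + 1),
      (if ∀ i, 0 < ((w i).1 : ℕ) + (w i).2 then
        (∏ i, ((((w i).1)! : ℝ) * ((w i).2)!)⁻¹) •
          opFold (bchWord x y (fun i => (w i).1) (fun i => (w i).2)) c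
       else 0)
      = ((expN (r + 1) (LieAlgebra.ad ℝ L x) * expN (r + 1) (LieAlgebra.ad ℝ L y) - 1) ^ n) c := by
  induction n with
  | zero => simp [bchWord, opFold]
  | succ n ih =>
    rw [pow_succ', Module.End.mul_apply, ← ih, expN_mul_sub_one,
      ← (Fin.consEquiv fun _ => Fin (r + 1) × Fin (r + 1)).sum_comp, Fintype.sum_prod_type]
    refine sum_congr rfl fun a _ => ?_
    split_ifs with ha
    · simp only [map_sum, smul_sum]
      refine sum_congr rfl fun w _ => ?_
      simp only [Fin.consEquiv_apply, Fin.forall_fin_succ, Fin.cons_zero, Fin.cons_succ, ha,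
        true_and]
      split_ifs with hw
      · simp only [Fin.prod_univ_succ, Fin.cons_zero, Fin.cons_succ, bchWord, List.ofFn_succ,
          List.flatten_cons, opFold_append, opFold_replicate, map_smul, smul_smul]
      · simp
    · refine sum_eq_zero fun w _ => ?_
      rw [if_neg]
      intro h
      exact ha (by simpa using h 0)

theorem sum_words {L : Type*} [LieRing L] [LieAlgebra ℝ L] (r : ℕ) (x y c : L) (n : ℕ) :
    ∑ p : Fin n → Fin (r + 1), ∑ q : Fin n → Fin (r + 1),
      (if ∀ i, 0 < (p i : ℕ) + q i then
        (∏ i, (((p i)! : ℝ) * (q i)!)⁻¹) • opFold (bchWord x y (fun i => p i) (fun i => q i)) c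
       else 0)
      = ((expN (r + 1) (LieAlgebra.ad ℝ L x) * expN (r + 1) (LieAlgebra.ad ℝ L y) - 1) ^ n) c := by
  rw [← sum_words_aux, ← (Equiv.arrowProdEquivProdArrow (Fin n) (fun _ => Fin (r + 1))
    (fun _ => Fin (r + 1))).symm.sum_comp, Fintype.sum_prod_type]
  rfl

/-- The commutator of an element that acts by counting letters with the product `bch`. -/
theorem D_bch {L : Type*} [LieRing L] [LieAlgebra ℝ L] (r : ℕ) (x y D : L) (hx : ⁅D, x⁆ = x)
    (hy : ⁅D, y⁆ = y) :
    ⁅D, bch r x y⁆ = - logN r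
      (expN (r + 1) (LieAlgebra.ad ℝ L x) * expN (r + 1) (LieAlgebra.ad ℝ L y) - 1) D := by
  have hIcc : Finset.Icc 1 r = Finset.Ico 1 (r + 1) := by ext; simp
  rw [logN, LinearMap.sum_apply, bch, lie_sum, ← sum_neg_distrib, hIcc, sum_Ico_eq_sum_range,
    Nat.add_sub_cancel]
  refine sum_congr rfl fun k _ => ?_
  rw [add_comm 1 k, LinearMap.smul_apply, ← sum_words]
  simp only [lie_sum, smul_sum, ← sum_neg_distrib]
  refine sum_congr rfl fun p _ => sum_congr rfl fun q _ => ?_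
  split_ifs with hpq
  · have hlen := length_bchWord x y (fun i => (p i : ℕ)) (fun i => (q i : ℕ))
    have hpos : 0 < ∑ i, ((p i : ℕ) + (q i : ℕ)) :=
      sum_pos (fun i _ => hpq i) univ_nonempty
    have hne : bchWord x y (fun i => (p i : ℕ)) (fun i => (q i : ℕ)) ≠ [] := by
      intro h0
      rw [h0] at hlen
      simp only [List.length_nil] at hlen
      omega
    have hmem : ∀ a ∈ bchWord x y (fun i => (p i : ℕ)) (fun i => (q i : ℕ)), ⁅D, a⁆ = a := by
      intro a ha
      rcases mem_bchWord ha with rfl | rfl <;> assumption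
    rw [lie_smul, D_nested D _ hmem, nested_eq D _ (fun a ha => by rw [← lie_skew, hmem a ha]) hne,
      hlen, smul_smul, smul_neg, smul_smul]
    congr 2
    have h1 : (∑ i, ((p i : ℝ) + q i)) = ((∑ i, ((p i : ℕ) + (q i : ℕ)) : ℕ) : ℝ) := by
      push_cast; rfl
    have h2 : ((∑ i, ((p i : ℕ) + (q i : ℕ)) : ℕ) : ℝ) ≠ 0 := by positivity
    rw [h1, Nat.add_sub_cancel]
    field_simp
    push_cast
    ring
  · simp

structure Filt (C : Type*) [Ring C] [Algebra ℝ C] (J : ℕ → Submodule ℝ C) (N : ℕ) : Prop where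
  mul : ∀ {i j a b}, a ∈ J i → b ∈ J j → a * b ∈ J (i + j)
  anti : ∀ {i a}, a ∈ J (i + 1) → a ∈ J i
  one : 1 ∈ J 0
  bot : ∀ {a}, a ∈ J N → a = 0

section
variable {C : Type*} [Ring C] [Algebra ℝ C] {J : ℕ → Submodule ℝ C} {N : ℕ}

theorem Filt.mono (h : Filt C J N) {i j : ℕ} (hij : i ≤ j) : J j ≤ J i := by
  induction hij with
  | refl => exact le_rfl
  | step _ ih => exact fun a ha => ih (h.anti ha)

theorem Filt.pow (h : Filt C J N) {a : C} (ha : a ∈ J 1) (k : ℕ) : a ^ k ∈ J k := by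
  induction k with
  | zero => simpa using h.one
  | succ k ih => rw [pow_succ]; exact h.mul ih ha

theorem Filt.pow_eq (h : Filt C J N) {a : C} (ha : a ∈ J 1) : a ^ N = 0 := h.bot (h.pow ha N)

theorem Filt.lie (h : Filt C J N) {i j : ℕ} {a b : C} (ha : a ∈ J i) (hb : b ∈ J j) :
    ⁅a, b⁆ ∈ J (i + j) := by
  rw [Ring.lie_def]
  exact sub_mem (h.mul ha hb) (by rw [add_comm]; exact h.mul hb ha)

theorem Filt.expN_sub_one (h : Filt C J N) {a : C} (ha : a ∈ J 1) (k : ℕ) :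
    expN (k + 1) a - 1 ∈ J 1 := by
  rw [expN, sum_range_succ']
  simp only [Nat.factorial_zero, Nat.cast_one, inv_one, pow_zero, one_smul, add_sub_cancel_right]
  exact sum_mem fun n _ => Submodule.smul_mem _ _ (h.mono (by omega) (h.pow ha (n + 1)))

theorem Filt.logN (h : Filt C J N) {a : C} (ha : a ∈ J 1) (k : ℕ) :
    logN k a ∈ J 1 :=
  sum_mem fun n _ => Submodule.smul_mem _ _ (h.mono (by omega) (h.pow ha (n + 1)))

theorem Filt.nested (h : Filt C J N) (l : List C) (hl : ∀ a ∈ l, a ∈ J 1) :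
    nestedBracket l ∈ J 1 := by
  induction l with
  | nil => exact zero_mem _
  | cons a l ih =>
    rcases l with _ | ⟨b, l⟩
    · exact hl a (by simp)
    · exact h.anti (h.lie (hl a (by simp)) (ih fun c hc => hl c (List.mem_cons_of_mem _ hc)))

theorem Filt.bch (h : Filt C J N) {x y : C} (hx : x ∈ J 1) (hy : y ∈ J 1) (r : ℕ) :
    bch r x y ∈ J 1 := by
  refine sum_mem fun n _ => sum_mem fun p _ => sum_mem fun q _ => ?_
  split_ifs
  · refine Submodule.smul_mem _ _ (h.nested _ fun a ha => ?_)
    rcases mem_bchWord ha with rfl | rfl <;> assumption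
  · exact zero_mem _

theorem Filt.ad_pow (h : Filt C J N) {x c : C} (hx : x ∈ J 1) {i : ℕ} (hc : c ∈ J i) (k : ℕ) :
    (LieAlgebra.ad ℝ C x ^ k) c ∈ J (i + k) := by
  induction k with
  | zero => simpa using hc
  | succ k ih =>
    rw [pow_succ', Module.End.mul_apply, LieAlgebra.ad_apply]
    have := h.lie hx ih
    rwa [show 1 + (i + k) = i + (k + 1) by omega] at this

theorem Filt.expN_ad (h : Filt C J N) {x c : C} (hx : x ∈ J 1) (hc : c ∈ J 0) :
    expN N (LieAlgebra.ad ℝ C x) c = expN N x * c * expN N (-x) := by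
  rw [← Carnot.expN_ad (h.pow_eq hx)]
  simp only [expN, LinearMap.sum_apply, LinearMap.smul_apply]
  refine sum_subset (range_subset_range.2 (by omega)) fun k _ hk => ?_
  have h1 := h.ad_pow hx hc k
  rw [h.bot (h.mono (by rw [mem_range] at hk; omega) h1), smul_zero]

/-- The Baker-Campbell-Hausdorff theorem in a filtered algebra with a letter-counting element. -/
theorem Filt.main {r : ℕ} (h : Filt C J (r + 1)) {x y D : C} (hx : x ∈ J 1) (hy : y ∈ J 1)
    (hD : D ∈ J 0) (hDx : ⁅D, x⁆ = x) (hDy : ⁅D, y⁆ = y)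
    (H : ∀ P ∈ J 1, ⁅D, P⁆ = 0 → P = 0) :
    expN (r + 1) (Carnot.bch r x y) = expN (r + 1) x * expN (r + 1) y := by
  set g := expN (r + 1) x * expN (r + 1) y with hg
  set g' := expN (r + 1) (-y) * expN (r + 1) (-x) with hg'
  have hgg' : g * g' = 1 := by
    rw [hg, hg', mul_assoc, ← mul_assoc _ _ (expN (r + 1) (-x)), expN_mul_neg (h.pow_eq hy),
      one_mul, expN_mul_neg (h.pow_eq hx)]
  have huv : ∀ {a b : C}, a - 1 ∈ J 1 → b - 1 ∈ J 1 → a * b - 1 ∈ J 1 := by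
    intro a b ha hb
    have : a * b - 1 = (a - 1) * (b - 1) + (a - 1) + (b - 1) := by noncomm_ring
    rw [this]
    exact add_mem (add_mem (h.anti (h.mul ha hb)) ha) hb
  have hu : g - 1 ∈ J 1 := huv (h.expN_sub_one hx r) (h.expN_sub_one hy r)
  have hu' : g' - 1 ∈ J 1 := huv (h.expN_sub_one (neg_mem hy) r) (h.expN_sub_one (neg_mem hx) r)
  set l := Carnot.logN (r + 1) (g - 1) with hl
  have hlJ : l ∈ J 1 := h.logN hu _
  have hel : expN (r + 1) l = g := by
    rw [hl, expN_logN (h.pow_eq hu)]; abel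
  have hel' : expN (r + 1) (-l) = g' := by
    have h1 : expN (r + 1) (-l) * g = 1 := by
      have := expN_mul_neg (N := r + 1) (a := -l) (h.pow_eq (neg_mem hlJ))
      rwa [neg_neg, hel] at this
    calc expN (r + 1) (-l) = expN (r + 1) (-l) * (g * g') := by rw [hgg', mul_one]
      _ = g' := by rw [← mul_assoc, h1, one_mul]
  -- the two operators
  set U : Module.End ℝ C := expN (r + 1) (LieAlgebra.ad ℝ C x) * expN (r + 1) (LieAlgebra.ad ℝ C y) - 1
    with hU
  set W : Module.End ℝ C := expN (2 * r + 1 + 1) (LieAlgebra.ad ℝ C l) - 1 with hW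
  have hWc : ∀ c, W c = g * c * g' - c := by
    intro c
    have := Carnot.expN_ad (N := r + 1) (h.pow_eq hlJ) c
    rw [hel, hel'] at this
    rw [hW, LinearMap.sub_apply, Module.End.one_apply, ← this]
    rfl
  have hstep : ∀ {i c}, c ∈ J i → W c ∈ J (i + 1) := by
    intro i c hc
    have : W c = (g - 1) * c + c * (g' - 1) + (g - 1) * c * (g' - 1) := by
      rw [hWc]; noncomm_ring
    rw [this]
    refine add_mem (add_mem ?_ (h.mul hc hu')) (h.anti (i := i + 1) ?_)
    · rw [add_comm]; exact h.mul hu hc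
    · have := h.mul (h.mul hu hc) hu'
      rwa [show 1 + i + 1 = i + 1 + 1 by omega] at this
  have hUc : ∀ {c}, c ∈ J 0 → U c = W c := by
    intro c hc
    have h0 : ∀ {a b c : C}, a - 1 ∈ J 1 → b - 1 ∈ J 1 → c ∈ J 0 → a * c * b ∈ J 0 := by
      intro a b c ha hb hc
      have ha' : a ∈ J 0 := by
        have := add_mem (h.anti ha) h.one; rwa [sub_add_cancel] at this
      have hb' : b ∈ J 0 := by
        have := add_mem (h.anti hb) h.one; rwa [sub_add_cancel] at this
      exact h.mul (h.mul ha' hc) hb'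
    rw [hU, LinearMap.sub_apply, Module.End.mul_apply, Module.End.one_apply, h.expN_ad hy hc,
      h.expN_ad hx (h0 (h.expN_sub_one hy r) (h.expN_sub_one (neg_mem hy) r) hc), hWc, hg, hg']
    simp only [mul_assoc]
  have hpow : ∀ k, (W ^ k) D ∈ J k ∧ (U ^ k) D = (W ^ k) D := by
    intro k
    induction k with
    | zero => exact ⟨by simpa using hD, by simp⟩
    | succ k ih =>
      rw [pow_succ', pow_succ', Module.End.mul_apply, Module.End.mul_apply, ih.2]
      exact ⟨hstep ih.1, hUc (h.mono (Nat.zero_le _) ih.1)⟩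
  have hlog : Carnot.logN r U D = ⁅l, D⁆ := by
    have h1 : Carnot.logN (2 * r + 1 + 1) W = LieAlgebra.ad ℝ C l :=
      logN_expN (by have := ad_pow_eq_zero (h.pow_eq hlJ); rwa [show 2 * (r + 1) = 2 * r + 1 + 1 by omega] at this)
    rw [← LieAlgebra.ad_apply (R := ℝ), ← h1]
    simp only [Carnot.logN, LinearMap.sum_apply, LinearMap.smul_apply]
    simp only [(hpow _).2]
    refine sum_subset (range_subset_range.2 (by omega)) fun k _ hk => ?_
    rw [h.bot (h.mono (by rw [mem_range] at hk; omega) (hpow (k + 1)).1), smul_zero]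
  have hfin : l = Carnot.bch r x y := by
    rw [← sub_eq_zero]
    refine H _ (sub_mem hlJ (h.bch hx hy r)) ?_
    rw [lie_sub, D_bch r x y D hDx hDy, hlog, ← lie_skew l D]
    abel
  rw [← hfin, hel]

end

section Rees
variable {M : Type*} [AddCommGroup M] [Module ℝ M] (F : ℕ → Submodule ℝ M)

abbrev Rees := (i : ℕ) → F i

def shift (a : Module.End ℝ M) (ha : ∀ i, ∀ v ∈ F i, a v ∈ F (i + 1)) : Module.End ℝ (Rees F) where
  toFun f := fun i => match i with
    | 0 => 0
    | i + 1 => ⟨a (f i), ha i _ (f i).2⟩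
  map_add' f g := by
    funext i
    cases i with
    | zero => simp
    | succ i => ext; simp
  map_smul' c f := by
    funext i
    cases i with
    | zero => simp
    | succ i => ext; simp

def reesDeg : Module.End ℝ (Rees F) where
  toFun f := fun i => (i : ℝ) • f i
  map_add' f g := by funext i; simp
  map_smul' c f := by funext i; simp [smul_comm c]

def reesFilt (k : ℕ) : Submodule ℝ (Module.End ℝ (Rees F)) where
  carrier := {T | ∀ m f, (∀ i < m, f i = 0) → ∀ i < m + k, T f i = 0}
  add_mem' hS hT m f hf i hi := by simp [hS m f hf i hi, hT m f hf i hi]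
  zero_mem' m f hf i hi := by simp
  smul_mem' c T hT m f hf i hi := by simp [hT m f hf i hi]

variable {F}

theorem reesFilt_filt {N : ℕ} (hN : ∀ i, N ≤ i → F i = ⊥) :
    Filt (Module.End ℝ (Rees F)) (reesFilt F) N where
  mul {i j a b} ha hb := by
    intro m f hf k hk
    exact ha (m + j) (b f) (hb m f hf) k (by omega)
  anti ha m f hf i hi := ha m f hf i (by omega)
  one m f hf i hi := hf i hi
  bot {a} ha := by
    ext f i
    by_cases h : i < N
    · have := ha 0 f (by simp) i (by omega)
      simp [this]
    · have h1 : ((a f i : F i) : M) ∈ (⊥ : Submodule ℝ M) := (hN i (not_lt.1 h)).le (a f i).2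
      simpa using h1

theorem shift_mem {a : Module.End ℝ M} (ha : ∀ i, ∀ v ∈ F i, a v ∈ F (i + 1)) :
    shift F a ha ∈ reesFilt F 1 := by
  intro m f hf i hi
  cases i with
  | zero => rfl
  | succ i =>
    ext
    change a (f i) = 0
    rw [hf i (by omega)]
    simp

theorem reesDeg_mem : reesDeg F ∈ reesFilt F 0 := by
  intro m f hf i hi
  change (i : ℝ) • f i = 0
  rw [hf i hi, smul_zero]

theorem reesDeg_lie {a : Module.End ℝ M} (ha : ∀ i, ∀ v ∈ F i, a v ∈ F (i + 1)) :
    ⁅reesDeg F, shift F a ha⁆ = shift F a ha := by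
  rw [Ring.lie_def]
  ext f i
  cases i with
  | zero =>
    simp [reesDeg, shift]
  | succ i =>
    simp [reesDeg, shift, add_smul]

theorem rees_comm {N : ℕ} (hN : ∀ i, N ≤ i → F i = ⊥) (P : Module.End ℝ (Rees F))
    (hP : P ∈ reesFilt F 1) (h : ⁅reesDeg F, P⁆ = 0) : P = 0 := by
  have hs : ∀ i (v : F i), P (Pi.single i v) = 0 := by
    intro i v
    have h1 : reesDeg F (P (Pi.single i v)) = (i : ℝ) • P (Pi.single i v) := by
      rw [Ring.lie_def, sub_eq_zero] at h
      have h2 := LinearMap.congr_fun h (Pi.single i v)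
      rw [Module.End.mul_apply, Module.End.mul_apply] at h2
      rw [h2, ← map_smul]
      congr 1
      funext j
      by_cases hj : j = i
      · subst hj; simp [reesDeg]
      · simp [reesDeg, Pi.single_eq_of_ne hj]
    funext j
    by_cases hj : j = i
    · subst hj
      exact hP j _ (fun k hk => Pi.single_eq_of_ne (by omega) _) j (by omega)
    · have h2 := congrFun h1 j
      change (j : ℝ) • P (Pi.single i v) j = (i : ℝ) • P (Pi.single i v) j at h2
      rw [← sub_eq_zero, ← sub_smul] at h2
      refine (smul_eq_zero.1 h2).resolve_left ?_
      exact sub_ne_zero.2 (by exact_mod_cast hj)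
  apply LinearMap.ext
  intro f
  have hf : f = ∑ i ∈ range N, Pi.single i (f i) := by
    funext j
    rw [Finset.sum_apply]
    by_cases hj : j < N
    · rw [sum_eq_single j]
      · simp
      · intro b _ hb; exact Pi.single_eq_of_ne (Ne.symm hb) _
      · intro h; exact absurd (mem_range.2 hj) h
    · have : Subsingleton (F j) := by rw [hN j (not_lt.1 hj)]; infer_instance
      exact Subsingleton.elim _ _
  rw [hf, map_sum]
  simp [hs]

def reesSum (F : ℕ → Submodule ℝ M) (N : ℕ) : Rees F →ₗ[ℝ] M :=
  ∑ i ∈ range N, (F i).subtype ∘ₗ LinearMap.proj i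

theorem reesSum_shift {N : ℕ} (hN : ∀ i, N ≤ i → F i = ⊥) {a : Module.End ℝ M}
    (ha : ∀ i, ∀ v ∈ F i, a v ∈ F (i + 1)) :
    reesSum F N ∘ₗ shift F a ha = a ∘ₗ reesSum F N := by
  apply LinearMap.ext
  intro f
  have h : ∑ i ∈ range (N + 1), ((shift F a ha f i : F i) : M) = ∑ i ∈ range N, a (f i) := by
    rw [sum_range_succ']
    simp [shift]
  rw [sum_range_succ] at h
  have h0 : ((shift F a ha f N : F N) : M) = 0 := by
    have h1 : ((shift F a ha f N : F N) : M) ∈ (⊥ : Submodule ℝ M) :=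
      (hN N le_rfl).le (shift F a ha f N).2
    simpa using h1
  rw [h0, add_zero] at h
  simp [reesSum, h]

/-- Truncated exponentials of intertwined endomorphisms are intertwined. -/
theorem inter_expN {V W : Type*} [AddCommGroup V] [Module ℝ V] [AddCommGroup W] [Module ℝ W]
    {p : V →ₗ[ℝ] W} {S : Module.End ℝ V} {T : Module.End ℝ W} (h : p ∘ₗ S = T ∘ₗ p) (N : ℕ) :
    p ∘ₗ expN N S = expN N T ∘ₗ p := by
  have hk : ∀ k : ℕ, p ∘ₗ (S ^ k) = (T ^ k) ∘ₗ p := by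
    intro k
    exact (Module.End.commute_pow_left_of_commute h.symm k).symm
  apply LinearMap.ext
  intro v
  simp only [expN, LinearMap.comp_apply, LinearMap.sum_apply, LinearMap.smul_apply, map_sum,
    map_smul]
  exact sum_congr rfl fun k _ => by rw [← LinearMap.comp_apply, hk]; rfl

theorem inter_nested {V W : Type*} [AddCommGroup V] [Module ℝ V] [AddCommGroup W] [Module ℝ W]
    {p : V →ₗ[ℝ] W} {S S' : Module.End ℝ V} {T T' : Module.End ℝ W} (h : p ∘ₗ S = T ∘ₗ p)
    (h' : p ∘ₗ S' = T' ∘ₗ p) (l : List Bool) :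
    p ∘ₗ nestedBracket (l.map fun b => cond b S S')
      = nestedBracket (l.map fun b => cond b T T') ∘ₗ p := by
  have h1 : ∀ b : Bool, p ∘ₗ (cond b S S') = (cond b T T') ∘ₗ p := by
    intro b; cases b <;> assumption
  induction l with
  | nil => simp [nestedBracket]
  | cons a l ih =>
    rcases l with _ | ⟨b, l⟩
    · exact h1 a
    · simp only [List.map_cons, nestedBracket, Ring.lie_def] at ih ⊢
      rw [LinearMap.comp_sub, LinearMap.sub_comp, Module.End.mul_eq_comp, Module.End.mul_eq_comp,
        Module.End.mul_eq_comp, Module.End.mul_eq_comp, ← LinearMap.comp_assoc, h1,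
        LinearMap.comp_assoc, ih, ← LinearMap.comp_assoc _ _ p, ih,
        LinearMap.comp_assoc, LinearMap.comp_assoc, h1]
      rfl

theorem bchWord_map {L L' : Type*} (f : L → L') (x y : L) {n : ℕ} (p q : Fin n → ℕ) :
    bchWord (f x) (f y) p q = (bchWord x y p q).map f := by
  simp [bchWord, List.map_flatten, List.map_ofFn, Function.comp_def]

theorem inter_bch {V W : Type*} [AddCommGroup V] [Module ℝ V] [AddCommGroup W] [Module ℝ W]
    {p : V →ₗ[ℝ] W} {S S' : Module.End ℝ V} {T T' : Module.End ℝ W} (h : p ∘ₗ S = T ∘ₗ p)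
    (h' : p ∘ₗ S' = T' ∘ₗ p) (r : ℕ) :
    p ∘ₗ bch r S S' = bch r T T' ∘ₗ p := by
  apply LinearMap.ext
  intro v
  simp only [bch, LinearMap.comp_apply, LinearMap.sum_apply, map_sum]
  refine sum_congr rfl fun n _ => sum_congr rfl fun a _ => sum_congr rfl fun b _ => ?_
  split_ifs
  · have := LinearMap.congr_fun (inter_nested h h'
      (bchWord true false (fun i => (a i : ℕ)) (fun i => (b i : ℕ)))) v
    rw [← bchWord_map, ← bchWord_map] at this
    simp only [LinearMap.smul_apply, map_smul]
    congr 1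
  · simp

theorem bch_filtered {r : ℕ} (h0 : F 0 = ⊤) (hN : ∀ i, r + 1 ≤ i → F i = ⊥)
    {a b : Module.End ℝ M} (ha : ∀ i, ∀ v ∈ F i, a v ∈ F (i + 1))
    (hb : ∀ i, ∀ v ∈ F i, b v ∈ F (i + 1)) :
    expN (r + 1) (bch r a b) = expN (r + 1) a * expN (r + 1) b := by
  have hA := reesSum_shift hN ha
  have hB := reesSum_shift hN hb
  have key := (reesFilt_filt hN).main (shift_mem ha) (shift_mem hb) reesDeg_mem (reesDeg_lie ha)
    (reesDeg_lie hb) (rees_comm hN)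
  apply LinearMap.ext
  intro v
  have hv : reesSum F (r + 1) (Pi.single 0 ⟨v, h0 ▸ Submodule.mem_top⟩) = v := by
    simp [reesSum, sum_range_succ']
  set w : Rees F := Pi.single 0 ⟨v, h0 ▸ Submodule.mem_top⟩
  have e1 := LinearMap.congr_fun (inter_expN (inter_bch hA hB r) (r + 1)) w
  have e2 := LinearMap.congr_fun (inter_expN hB (r + 1)) w
  have e3 := LinearMap.congr_fun (inter_expN hA (r + 1)) (expN (r + 1) (shift F b hb) w)
  simp only [LinearMap.comp_apply, hv] at e1 e2 e3
  rw [← e1, key, Module.End.mul_apply, Module.End.mul_apply, e3, e2]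

end Rees

/-- Homomorphisms of Lie algebras preserve the Baker-Campbell-Hausdorff product. -/
theorem map_bch {L L' : Type*} [LieRing L] [LieAlgebra ℝ L] [LieRing L'] [LieAlgebra ℝ L']
    (f : L →ₗ⁅ℝ⁆ L') (r : ℕ) (x y : L) : f (bch r x y) = bch r (f x) (f y) := by
  have hn : ∀ l : List L, f (nestedBracket l) = nestedBracket (l.map f) := by
    intro l
    induction l with
    | nil => simp [nestedBracket]
    | cons a l ih =>
      rcases l with _ | ⟨b, l⟩
      · rfl
      · simp only [List.map_cons, nestedBracket, LieHom.map_lie] at ih ⊢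
        rw [ih]
  simp only [bch, map_sum]
  refine sum_congr rfl fun n _ => sum_congr rfl fun a _ => sum_congr rfl fun b _ => ?_
  split_ifs
  · rw [map_smul, hn, bchWord_map]
  · simp

namespace Stratification
variable {L : Type*} [LieRing L] [LieAlgebra ℝ L] {r : ℕ} (S : Stratification L r)

def gr (k : ℕ) : Submodule ℝ L := if 1 ≤ k ∧ k ≤ r then S.layer k else ⊥

theorem gr_eq {k : ℕ} (h : 1 ≤ k) (h' : k ≤ r) : S.gr k = S.layer k := if_pos ⟨h, h'⟩

theorem lie_gr_one {l : ℕ} (hl : 1 ≤ l) {x y : L} (hx : x ∈ S.gr 1) (hy : y ∈ S.gr l) :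
    ⁅x, y⁆ ∈ S.gr (l + 1) := by
  by_cases h : l ≤ r
  · rw [S.gr_eq hl h] at hy
    rw [S.gr_eq le_rfl (hl.trans h)] at hx
    rcases h.lt_or_eq with h | rfl
    · rw [S.gr_eq (by omega) (by omega), ← S.lie_layer l hl h]
      exact Submodule.subset_span ⟨x, hx, y, hy, rfl⟩
    · rw [S.lie_top x hx y hy]; exact zero_mem _
  · rw [gr, if_neg (by omega), Submodule.mem_bot] at hy
    rw [hy, lie_zero]; exact zero_mem _

theorem lie_gr {i : ℕ} (hi : 1 ≤ i) : ∀ {j : ℕ}, 1 ≤ j → ∀ {x y : L}, x ∈ S.gr i → y ∈ S.gr j →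
    ⁅x, y⁆ ∈ S.gr (i + j) := by
  induction i, hi using Nat.le_induction with
  | base =>
    intro j hj x y hx hy
    rw [add_comm]; exact S.lie_gr_one hj hx hy
  | succ i hi ih =>
    intro j hj x y hx hy
    by_cases h : i + 1 ≤ r
    · rw [S.gr_eq (by omega) h, ← S.lie_layer i hi (by omega)] at hx
      induction hx using Submodule.span_induction with
      | mem z hz =>
        obtain ⟨a, ha, b, hb, rfl⟩ := hz
        rw [← S.gr_eq le_rfl (by omega)] at ha
        rw [← S.gr_eq hi (by omega)] at hb
        rw [lie_lie]
        refine sub_mem ?_ ?_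
        · have := S.lie_gr_one (l := i + j) (by omega) ha (ih hj hb hy)
          rwa [show i + j + 1 = i + 1 + j by omega] at this
        · have := ih (j := j + 1) (by omega) hb (S.lie_gr_one hj ha hy)
          rwa [show i + (j + 1) = i + 1 + j by omega] at this
      | zero => rw [zero_lie]; exact zero_mem _
      | add a b _ _ ha hb => rw [add_lie]; exact add_mem ha hb
      | smul c a _ ha => rw [smul_lie]; exact Submodule.smul_mem _ _ ha
    · rw [gr, if_neg (by omega), Submodule.mem_bot] at hx
      rw [hx, zero_lie]; exact zero_mem _

def tail (k : ℕ) : Submodule ℝ L := ⨆ j : {j : ℕ // k ≤ j}, S.gr j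

theorem gr_le_tail {k j : ℕ} (h : k ≤ j) : S.gr j ≤ S.tail k :=
  le_iSup (fun j : {j : ℕ // k ≤ j} => S.gr j) ⟨j, h⟩

theorem tail_one : S.tail 1 = ⊤ := by
  rw [eq_top_iff, ← S.isInternal.submodule_iSup_eq_top]
  refine iSup_le fun l => ?_
  rw [← S.gr_eq (k := l + 1) (by omega) (by omega)]
  exact S.gr_le_tail (by omega)

theorem tail_bot {k : ℕ} (h : r + 1 ≤ k) : S.tail k = ⊥ := by
  rw [eq_bot_iff]
  refine iSup_le fun j => ?_
  rw [gr, if_neg (by have := j.2; omega)]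

theorem lie_tail {k : ℕ} (hk : 1 ≤ k) (x : L) {y : L} (hy : y ∈ S.tail k) :
    ⁅x, y⁆ ∈ S.tail (k + 1) := by
  have hx : x ∈ S.tail 1 := S.tail_one ▸ Submodule.mem_top
  induction hx using Submodule.iSup_induction' with
  | mem i x hx =>
    induction hy using Submodule.iSup_induction' with
    | mem j y hy =>
      have := S.lie_gr i.2 (hk.trans j.2) hx hy
      exact S.gr_le_tail (by have := i.2; have := j.2; omega) this
    | zero => rw [lie_zero]; exact zero_mem _
    | add a b _ _ ha hb => rw [lie_add]; exact add_mem ha hb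
  | zero => rw [zero_lie]; exact zero_mem _
  | add a b _ _ ha hb => rw [add_lie]; exact add_mem ha hb

/-- The derivation that is multiplication by `l` on the layer `Vₗ`. -/
noncomputable def degree : L →ₗ[ℝ] L :=
  S.fullBasis.constr ℝ fun i => ((i.1 : ℝ) + 1) • S.fullBasis i

theorem degree_gr {k : ℕ} {x : L} (hx : x ∈ S.gr k) : S.degree x = (k : ℝ) • x := by
  by_cases h : 1 ≤ k ∧ k ≤ r
  · rw [S.gr_eq h.1 h.2] at hx
    obtain ⟨l, rfl⟩ : ∃ l : Fin r, k = l + 1 := ⟨⟨k - 1, by omega⟩, by simp; omega⟩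
    have : (⟨x, hx⟩ : S.layer (l + 1)) ∈ Submodule.span ℝ (Set.range (S.basis l)) := by
      rw [(S.basis l).span_eq]; exact Submodule.mem_top
    suffices H : ∀ z : S.layer (l + 1), S.degree z = (((l + 1 : ℕ)) : ℝ) • (z : L) from H ⟨x, hx⟩
    intro z
    have e : S.degree ∘ₗ (S.layer (l + 1)).subtype = (((l + 1 : ℕ)) : ℝ) • (S.layer (l + 1)).subtype := by
      refine (S.basis l).ext fun j => ?_
      have hb : S.fullBasis ⟨l, j⟩ = (S.basis l j : L) := by
        simp [fullBasis]
      simp only [LinearMap.comp_apply, LinearMap.smul_apply, Submodule.subtype_apply, ← hb]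
      rw [degree, Module.Basis.constr_basis]
      push_cast; rfl
    exact LinearMap.congr_fun e z
  · rw [gr, if_neg h, Submodule.mem_bot] at hx
    rw [hx]; simp

theorem degree_lie (x y : L) : S.degree ⁅x, y⁆ = ⁅S.degree x, y⁆ + ⁅x, S.degree y⁆ := by
  have hx : x ∈ S.tail 1 := S.tail_one ▸ Submodule.mem_top
  have hy : y ∈ S.tail 1 := S.tail_one ▸ Submodule.mem_top
  induction hx using Submodule.iSup_induction' with
  | mem i x hx =>
    induction hy using Submodule.iSup_induction' with
    | mem j y hy =>
      rw [S.degree_gr (S.lie_gr i.2 j.2 hx hy), S.degree_gr hx, S.degree_gr hy, smul_lie, lie_smul,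
        ← add_smul]
      push_cast; rfl
    | zero => simp
    | add a b _ _ ha hb => rw [lie_add, map_add, map_add, lie_add, lie_add, ha, hb]; abel
  | zero => simp
  | add a b _ _ ha hb => rw [add_lie, map_add, map_add, add_lie, add_lie, ha, hb]; abel

theorem degree_injective : Function.Injective S.degree := by
  rw [← LinearMap.ker_eq_bot, LinearMap.ker_eq_bot']
  intro x hx
  apply S.fullBasis.repr.injective
  rw [map_zero]
  ext i
  have h : S.fullBasis.repr (S.degree x) i = ((i.1 : ℝ) + 1) * S.fullBasis.repr x i := by
    have e : S.fullBasis.coord i ∘ₗ S.degree = ((i.1 : ℝ) + 1) • S.fullBasis.coord i := by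
      refine S.fullBasis.ext fun j => ?_
      simp only [degree, LinearMap.comp_apply, Module.Basis.constr_basis, LinearMap.smul_apply,
        map_smul, Module.Basis.coord_apply, Module.Basis.repr_self, smul_eq_mul]
      by_cases hij : j = i
      · subst hij; rfl
      · simp [Finsupp.single_eq_of_ne (Ne.symm hij)]
    exact LinearMap.congr_fun e x
  rw [hx, map_zero] at h
  have h2 : ((i.1 : ℝ) + 1) ≠ 0 := by positivity
  exact (mul_eq_zero.1 h.symm).resolve_left h2

/-- A faithful representation: the adjoint one, extended by the degree derivation. -/
noncomputable def rep : L →ₗ⁅ℝ⁆ Module.End ℝ (L × ℝ) where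
  toFun x :=
    { toFun := fun v => (⁅x, v.1⁆ + v.2 • S.degree x, 0)
      map_add' := fun v w => by ext <;> simp [add_smul]; abel
      map_smul' := fun c v => by ext <;> simp [mul_smul] }
  map_add' x y := by
    apply LinearMap.ext; intro v
    ext <;> simp; abel
  map_smul' c x := by
    apply LinearMap.ext; intro v
    ext <;> simp [smul_comm c]
  map_lie' {x y} := by
    apply LinearMap.ext; intro v
    rw [Ring.lie_def]
    ext
    · simp [S.degree_lie]
      rw [← lie_skew (S.degree x) y, smul_neg]
      abel
    · simp

theorem rep_apply (x : L) (v : L × ℝ) : S.rep x v = (⁅x, v.1⁆ + v.2 • S.degree x, 0) := rfl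

theorem rep_injective : Function.Injective S.rep := by
  intro x y h
  have := congrArg Prod.fst (LinearMap.congr_fun h (0, 1))
  simp only [rep_apply, lie_zero, one_smul, zero_add] at this
  exact S.degree_injective this

def repFilt (k : ℕ) : Submodule ℝ (L × ℝ) := if k = 0 then ⊤ else (S.tail k).prod ⊥

theorem rep_filt (x : L) : ∀ i, ∀ v ∈ S.repFilt i, S.rep x v ∈ S.repFilt (i + 1) := by
  intro i v hv
  rw [repFilt, if_neg (by omega), rep_apply, Submodule.mem_prod]
  refine ⟨?_, Submodule.zero_mem _⟩
  by_cases h : i = 0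
  · subst h; rw [tail_one]; exact Submodule.mem_top
  · rw [repFilt, if_neg h, Submodule.mem_prod, Submodule.mem_bot] at hv
    rw [hv.2, zero_smul, add_zero]
    exact S.lie_tail (by omega) x hv.1

theorem repFilt_bot : ∀ i, r + 1 ≤ i → S.repFilt i = ⊥ := by
  intro i hi
  rw [repFilt, if_neg (by omega), S.tail_bot hi, Submodule.prod_bot]

theorem rep_pow (x : L) : S.rep x ^ (r + 1) = 0 := by
  have h : ∀ k v, (S.rep x ^ k) v ∈ S.repFilt k := by
    intro k v
    induction k with
    | zero => simp [repFilt]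
    | succ k ih => rw [pow_succ', Module.End.mul_apply]; exact S.rep_filt x k _ ih
  apply LinearMap.ext
  intro v
  have := h (r + 1) v
  rw [S.repFilt_bot _ le_rfl] at this
  simpa using this

noncomputable def expRep (x : L) : Module.End ℝ (L × ℝ) := expN (r + 1) (S.rep x)

theorem expRep_bch (x y : L) : S.expRep (bch r x y) = S.expRep x * S.expRep y := by
  rw [expRep, map_bch]
  exact bch_filtered (F := S.repFilt) (by simp [repFilt]) S.repFilt_bot (S.rep_filt x) (S.rep_filt y)

theorem expRep_injective : Function.Injective S.expRep := by
  intro x y h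
  apply S.rep_injective
  rw [← logN_expN (S.rep_pow x), ← logN_expN (S.rep_pow y)]
  change logN _ (S.expRep x - 1) = logN _ (S.expRep y - 1)
  rw [h]

theorem expRep_zero : S.expRep 0 = 1 := by
  rw [expRep, map_zero, expN, sum_range_succ']
  simp

theorem expRep_neg_mul (x : L) : S.expRep (-x) * S.expRep x = 1 := by
  have := expN_mul_neg (N := r + 1) (a := S.rep (-x)) (S.rep_pow _)
  rwa [map_neg, neg_neg, ← map_neg] at this

theorem bch_assoc (S : Stratification L r) (x y z : L) : bch r (bch r x y) z = bch r x (bch r y z) := by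
  apply S.expRep_injective
  simp only [expRep_bch, mul_assoc]

noncomputable instance : Group (CarnotGroup S) :=
  Group.ofLeftAxioms
    (fun u v w => S.toLie_injective (by simp only [toLie_mul, S.bch_assoc]))
    (fun u => S.toLie_injective (S.expRep_injective (by
      rw [toLie_mul, expRep_bch, toLie_one, expRep_zero, one_mul])))
    (fun u => S.toLie_injective (S.expRep_injective (by
      rw [toLie_mul, expRep_bch, toLie_one, expRep_zero, toLie_inv, expRep_neg_mul])))

instance : IsTopologicalGroup (CarnotGroup S) where
  continuous_inv := by
    refine continuous_pi fun l => ?_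
    exact (continuous_apply l).neg
  continuous_mul := by
    have : Module.Finite ℝ L := Module.Finite.of_basis S.fullBasis
    obtain ⟨_, _⟩ : ∃ _t : TopologicalSpace L, IsModuleTopology ℝ L := 
      ⟨moduleTopology ℝ L, @IsModuleTopology.mk _ _ _ _ _ (moduleTopology ℝ L) rfl⟩
    have : ContinuousAdd L := IsModuleTopology.toContinuousAdd ℝ L
    have hto : Continuous S.toLie := by
      refine continuous_finsetSum _ fun l _ => continuous_finsetSum _ fun j _ => ?_
      refine Continuous.smul ?_ continuous_const
      have h1 : Continuous fun u : CarnotGroup S => u l := continuous_apply l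
      exact (PiLp.continuous_apply 2 _ j).comp h1
    have hof : Continuous S.ofLie := by
      refine continuous_pi fun l => ?_
      refine (PiLp.continuous_toLp 2 _).comp (continuous_pi fun j => ?_)
      exact IsModuleTopology.continuous_of_linearMap (S.fullBasis.coord ⟨l, j⟩)
    have hlie : Continuous fun p : L × L => ⁅p.1, p.2⁆ :=
      IsModuleTopology.continuous_bilinear_of_finite_left (LieModule.toEnd ℝ L L : L →ₗ[ℝ] L →ₗ[ℝ] L)
    have hnest : ∀ l : List Bool, Continuous fun p : L × L =>
        nestedBracket (l.map fun b => cond b p.1 p.2) := by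
      intro l
      induction l with
      | nil => exact continuous_const
      | cons a l ih =>
        have ha : Continuous fun p : L × L => cond a p.1 p.2 := by
          cases a
          · exact continuous_snd
          · exact continuous_fst
        rcases l with _ | ⟨b, l⟩
        · exact ha
        · exact hlie.comp (ha.prodMk ih)
    have hbch : Continuous fun p : L × L => bch r p.1 p.2 := by
      refine continuous_finsetSum _ fun n _ => continuous_finsetSum _ fun a _ =>
        continuous_finsetSum _ fun b _ => ?_
      split_ifs
      · refine Continuous.const_smul ?_ _
        have := hnest (bchWord true false (fun i => (a i : ℕ)) (fun i => (b i : ℕ)))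
        refine this.congr fun p => ?_
        rw [← bchWord_map]
        rfl
      · exact continuous_const
    have gen : ∀ B : L × L → L, Continuous B →
        Continuous fun p : CarnotGroup S × CarnotGroup S => S.ofLie (B (S.toLie p.1, S.toLie p.2)) :=
      fun B hB => hof.comp (hB.comp ((hto.comp continuous_fst).prodMk (hto.comp continuous_snd)))
    have hfin := gen (fun p => bch r p.1 p.2) hbch
    exact hfin.congr fun p => (S.mul_def p.1 p.2).symm

end Stratification

end

end Carnot

/-! Put `k w = |w| ^ (-Q)`, so that the kernel is `k ^ (λ / Q)`. Balls of radius `R` have measure at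
most a constant times `R ^ Q`; hence `k` is in weak `L¹`, that is, `μ {t ≤ k} ≤ c / t`. Up to their
norms, `|f|` and `|g|` are powers `a ^ (1 / r)` and `b ^ (1 / s)` of weights with integral at most
one. It remains to bound the double integral of `a(u) ^ α * b(v) ^ β * k(u⁻¹v) ^ κ`, where `α = 1 /
r`, `β = 1 / s`, `κ = λ / Q` lie in `(0, 1)` and have sum 2.

This needs neither interpolation nor rearrangement. By `rpow_mul_rpow_mul_rpow_le` the integrand is
pointwise at most `a * b` plus two terms of degree 2, each of which contains `k` and only one of the
weights. In these the exponent of `k` is below one where `k` is large and above one where `k` is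
small, so integrating out the free variable leaves a multiple of the weight
(`lintegral_splitMonomial_le`).

The volume bound rests on Lebesgue measure being a Haar measure. In exponential coordinates a left
translation adds to each layer a quantity that depends only on the lower layers of the point
(`bch_sub_sub_mem_tail`, `mul_apply_sub_apply`), and such triangular maps preserve Lebesgue measure
by Fubini (`measurePreserving_pi_of_triangular`). A ball lies in a box of volume proportional to `R
^ Q`, and uniqueness of Haar measure passes the bound on to `μ`. -/

open MeasureTheory Measure
open scoped ENNReal

/-! ### A weak-type Young inequality

For weights `a`, `b` with integral at most one and a kernel `k` in weak `L¹`, the integrand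
`a ^ α * b ^ β * k ^ κ` with `α + β + κ = 2` is bounded pointwise by three terms, each of which
can be integrated directly. -/

/-- The monomial `a ^ (2 - p) * k ^ p` where `a ≤ k` and `a ^ (2 - q) * k ^ q` where `k < a`. If `k`
is in weak `L¹` and `p < 1 < q`, then its integral is at most a constant times `a`. -/
noncomputable def splitMonomial (p q a k : ℝ) : ℝ :=
  if a ≤ k then a ^ (2 - p) * k ^ p else a ^ (2 - q) * k ^ q

theorem splitMonomial_nonneg {p q a k : ℝ} (ha : 0 ≤ a) (hk : 0 ≤ k) :
    0 ≤ splitMonomial p q a k := by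
  unfold splitMonomial
  split_ifs <;> positivity

/-- In logarithmic variables all comparisons are linear. Either the monomial is at most `a * b`, or
`b ^ (1 - β) < k ^ κ * a ^ (α - 1)`. In the second case `b` can be eliminated: by `b ≤ a` where `a ≤
k`, and by the failed comparison where `k < a`. Degree 2 is kept, and the exponent of `k` becomes
`κ` or `κ / (1 - β)`. -/
theorem rpow_mul_rpow_mul_rpow_le_of_le {α β κ a b k : ℝ} (hβ0 : 0 < β) (hβ : β < 1)
    (hsum : α + β + κ = 2) (ha : 0 < a) (hb : 0 < b) (hk : 0 < k) (hba : b ≤ a) :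
    a ^ α * b ^ β * k ^ κ ≤ a * b + splitMonomial κ (κ / (1 - β)) a k := by
  have h1β : 0 < 1 - β := by linarith
  obtain ⟨x, rfl⟩ : ∃ x, Real.exp x = a := ⟨_, Real.exp_log ha⟩
  obtain ⟨y, rfl⟩ : ∃ x, Real.exp x = b := ⟨_, Real.exp_log hb⟩
  obtain ⟨z, rfl⟩ : ∃ x, Real.exp x = k := ⟨_, Real.exp_log hk⟩
  have hxy : y ≤ x := Real.exp_le_exp.1 hba
  unfold splitMonomial
  simp only [← Real.exp_mul, ← Real.exp_add, Real.exp_le_exp]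
  by_cases h1 : κ * z ≤ (1 - α) * x + (1 - β) * y
  · refine le_add_of_le_of_nonneg (Real.exp_le_exp.2 (by linarith)) ?_
    split_ifs <;> positivity
  · refine le_add_of_nonneg_of_le (by positivity) ?_
    split_ifs with h
    · rw [Real.exp_le_exp]
      have : y * β ≤ x * β := mul_le_mul_of_nonneg_right hxy hβ0.le
      have : x * (2 - κ) = x * α + x * β := by rw [← mul_add, ← hsum]; ring
      linarith
    · rw [Real.exp_le_exp]
      -- The last summand is the logarithm of the upper bound for `b ^ β` that comes from the failed
      -- comparison `h1`.
      have e : x * (2 - κ / (1 - β)) + z * (κ / (1 - β))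
          = x * α + z * κ + (β * (κ * z - (1 - α) * x)) / (1 - β) := by
        have : κ = 2 - α - β := by linarith
        subst this
        field_simp
        ring
      rw [e]
      have : y * β ≤ (β * (κ * z - (1 - α) * x)) / (1 - β) := by
        rw [le_div_iff₀ h1β]
        nlinarith
      linarith

theorem rpow_mul_rpow_mul_rpow_le {α β κ a b k : ℝ} (hα0 : 0 < α) (hα : α < 1) (hβ0 : 0 < β)
    (hβ : β < 1) (hκ : 0 < κ) (hsum : α + β + κ = 2) (ha : 0 ≤ a) (hb : 0 ≤ b) (hk : 0 ≤ k) :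
    a ^ α * b ^ β * k ^ κ ≤ a * b + splitMonomial κ (κ / (1 - β)) a k
      + splitMonomial κ (κ / (1 - α)) b k := by
  have n1 := splitMonomial_nonneg (p := κ) (q := κ / (1 - β)) ha hk
  have n2 := splitMonomial_nonneg (p := κ) (q := κ / (1 - α)) hb hk
  have n3 := mul_nonneg ha hb
  rcases ha.eq_or_lt with rfl | ha
  · rw [Real.zero_rpow hα0.ne']; linarith
  rcases hb.eq_or_lt with rfl | hb
  · rw [Real.zero_rpow hβ0.ne']; linarith
  rcases hk.eq_or_lt with rfl | hk
  · rw [Real.zero_rpow hκ.ne']; linarith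
  -- The larger of the two weights is the one kept; the two cases differ by exchanging `(a, α)` and
  -- `(b, β)`.
  rcases le_total b a with h | h
  · have := rpow_mul_rpow_mul_rpow_le_of_le hβ0 hβ hsum ha hb hk h
    linarith
  · have := rpow_mul_rpow_mul_rpow_le_of_le (α := β) (β := α) (κ := κ) hα0 hα (by linarith) hb ha hk h
    have e : b ^ β * a ^ α * k ^ κ = a ^ α * b ^ β * k ^ κ := by ring
    linarith

/-- A geometric dyadic bound for the integral of a function controlled by level sets of a weak `L¹`
function. -/
theorem lintegral_le_of_dyadic {G : Type*} [MeasurableSpace G] {μ : Measure G} {k F : G → ℝ}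
    (hk : Measurable k) {c M ρ : ℝ} (hc : 0 ≤ c) (hM : 0 ≤ M) (hρ0 : 0 ≤ ρ) (hρ : ρ < 1)
    (hμ : ∀ t, 0 < t → μ {w | t ≤ k w} ≤ ENNReal.ofReal (c / t))
    {t v : ℕ → ℝ} (ht : ∀ n, 0 < t n) (hv : ∀ n, 0 ≤ v n) (htv : ∀ n, v n / t n ≤ M * ρ ^ n)
    (hF : ∀ w, F w ≤ 0 ∨ ∃ n, t n ≤ k w ∧ F w ≤ v n) :
    ∫⁻ w, ENNReal.ofReal (F w) ∂μ ≤ ENNReal.ofReal (c * M * (1 - ρ)⁻¹) := by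
  have hmeas : ∀ n, MeasurableSet {w | t n ≤ k w} := fun n => measurableSet_le measurable_const hk
  calc ∫⁻ w, ENNReal.ofReal (F w) ∂μ
      ≤ ∫⁻ w, ∑' n, {w | t n ≤ k w}.indicator (fun _ => ENNReal.ofReal (v n)) w ∂μ := by
        refine lintegral_mono fun w => ?_
        rcases hF w with h | ⟨n, hn, h⟩
        · rw [ENNReal.ofReal_of_nonpos h]; exact zero_le
        · refine le_trans ?_ (ENNReal.le_tsum n)
          rw [Set.indicator_of_mem (show w ∈ {w | t n ≤ k w} from hn)]
          exact ENNReal.ofReal_le_ofReal h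
    _ = ∑' n, ENNReal.ofReal (v n) * μ {w | t n ≤ k w} := by
        rw [lintegral_tsum fun n => (measurable_const.indicator (hmeas n)).aemeasurable]
        exact tsum_congr fun n => lintegral_indicator_const (hmeas n) _
    _ ≤ ∑' n, ENNReal.ofReal (c * M * ρ ^ n) := by
        refine ENNReal.tsum_le_tsum fun n => ?_
        refine (mul_le_mul_right (hμ _ (ht n)) _).trans ?_
        rw [← ENNReal.ofReal_mul (hv n)]
        refine ENNReal.ofReal_le_ofReal ?_
        calc v n * (c / t n) = c * (v n / t n) := by ring
          _ ≤ c * (M * ρ ^ n) := mul_le_mul_of_nonneg_left (htv n) hc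
          _ = _ := by ring
    _ = ENNReal.ofReal (c * M * (1 - ρ)⁻¹) := by
        rw [← ENNReal.ofReal_tsum_of_nonneg (fun n => by positivity)
          ((summable_geometric_of_lt_one hρ0 hρ).mul_left _), tsum_mul_left,
          tsum_geometric_of_lt_one hρ0 hρ]

/-- Slice dyadically at the levels `2 ^ n * a` above `a` and `a / 2 ^ (n + 1)` below it. The
integrand has degree 2 in `(a, k)` and the weak-type bound divides by one level, so each slice
contributes a multiple of `a`. The ratios `2 ^ (p - 1)` and `2 ^ (1 - q)` are less than one exactly
because `p < 1 < q`. -/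
theorem lintegral_splitMonomial_le {G : Type*} [MeasurableSpace G] {μ : Measure G} {k : G → ℝ}
    (hk : Measurable k) (hk0 : ∀ w, 0 ≤ k w) {c : ℝ} (hc : 0 ≤ c)
    (hμ : ∀ t, 0 < t → μ {w | t ≤ k w} ≤ ENNReal.ofReal (c / t))
    {p q : ℝ} (hp0 : 0 < p) (hp : p < 1) (hq : 1 < q) :
    ∃ C : ℝ, 0 ≤ C ∧ ∀ a : ℝ, 0 ≤ a →
      ∫⁻ w, ENNReal.ofReal (splitMonomial p q a (k w)) ∂μ ≤ ENNReal.ofReal (C * a) := by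
  have hρp : (2 : ℝ) ^ (p - 1) < 1 := Real.rpow_lt_one_of_one_lt_of_neg (by norm_num) (by linarith)
  have hρq : (2 : ℝ) ^ (1 - q) < 1 := Real.rpow_lt_one_of_one_lt_of_neg (by norm_num) (by linarith)
  have hCp : 0 ≤ (1 - (2 : ℝ) ^ (p - 1))⁻¹ := inv_nonneg.2 (by linarith)
  have hCq : 0 ≤ (1 - (2 : ℝ) ^ (1 - q))⁻¹ := inv_nonneg.2 (by linarith)
  refine ⟨c * 2 ^ p * (1 - (2 : ℝ) ^ (p - 1))⁻¹ + c * 2 * (1 - (2 : ℝ) ^ (1 - q))⁻¹, by positivity,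
    fun a ha => ?_⟩
  rcases ha.eq_or_lt with rfl | ha
  · have : ∀ w, splitMonomial p q 0 (k w) = 0 := fun w => by
      rw [splitMonomial, if_pos (hk0 w), Real.zero_rpow (by linarith), zero_mul]
    simp [this]
  have dyadic : ∀ s : ℝ, 1 ≤ s → ∃ n : ℕ, (2 : ℝ) ^ n ≤ s ∧ s < 2 ^ (n + 1) := fun s hs =>
    exists_nat_pow_near hs (by norm_num)
  -- The factor `2 ^ p` is the price of replacing `k` by the upper end `2 ^ (n + 1) * a` of its
  -- slice.
  have hlow : ∫⁻ w, ENNReal.ofReal (if a ≤ k w then a ^ (2 - p) * k w ^ p else 0) ∂μ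
      ≤ ENNReal.ofReal (c * (2 ^ p * a) * (1 - (2 : ℝ) ^ (p - 1))⁻¹) := by
    refine lintegral_le_of_dyadic (t := fun n => 2 ^ n * a)
      (v := fun n => a ^ (2 - p) * (2 ^ (n + 1) * a) ^ p)
      hk hc (by positivity) (by positivity) hρp hμ (fun n => by positivity) (fun n => by positivity)
      (fun n => ?_) fun w => ?_
    · apply le_of_eq
      rw [Real.mul_rpow (by positivity) ha.le, ← Real.rpow_natCast 2 n, ← Real.rpow_natCast 2 (n + 1),
        ← Real.rpow_natCast _ n, ← Real.rpow_mul (by norm_num), ← Real.rpow_mul (by norm_num)]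
      rw [div_eq_iff (by positivity)]
      calc a ^ (2 - p) * (2 ^ (((n + 1 : ℕ) : ℝ) * p) * a ^ p)
          = 2 ^ (((n + 1 : ℕ) : ℝ) * p) * (a ^ (2 - p) * a ^ p) := by ring
        _ = 2 ^ (p + (p - 1) * n + n) * a ^ (2 : ℝ) := by
          rw [← Real.rpow_add ha]; push_cast; ring_nf
        _ = _ := by
          rw [Real.rpow_add (by norm_num), Real.rpow_add (by norm_num), Real.rpow_two]; ring
    · by_cases h : a ≤ k w
      · right
        obtain ⟨n, h1, h2⟩ := dyadic (k w / a) ((one_le_div ha).2 h)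
        refine ⟨n, (le_div_iff₀ ha).1 h1, ?_⟩
        rw [if_pos h]
        exact mul_le_mul_of_nonneg_left (Real.rpow_le_rpow (hk0 w) ((div_le_iff₀ ha).1 h2.le) hp0.le)
          (by positivity)
      · left; rw [if_neg h]
  -- The value is taken at the upper end `a / 2 ^ n` and the level set at the lower end, hence the
  -- factor 2.
  have hhigh : ∫⁻ w, ENNReal.ofReal (if a ≤ k w then 0 else a ^ (2 - q) * k w ^ q) ∂μ
      ≤ ENNReal.ofReal (c * (2 * a) * (1 - (2 : ℝ) ^ (1 - q))⁻¹) := by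
    refine lintegral_le_of_dyadic (t := fun n => a / 2 ^ (n + 1))
      (v := fun n => a ^ (2 - q) * (a / 2 ^ n) ^ q)
      hk hc (by positivity) (by positivity) hρq hμ (fun n => by positivity) (fun n => by positivity)
      (fun n => ?_) fun w => ?_
    · apply le_of_eq
      rw [Real.div_rpow ha.le (by positivity), ← Real.rpow_natCast 2 n, ← Real.rpow_natCast 2 (n + 1),
        ← Real.rpow_natCast _ n, ← Real.rpow_mul (by norm_num), ← Real.rpow_mul (by norm_num)]
      rw [div_eq_iff (by positivity)]
      have e1 : a ^ (2 - q) * a ^ q = a * a := by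
        rw [← Real.rpow_add ha, sub_add_cancel, Real.rpow_two, sq]
      have e2 : (2 : ℝ) ^ ((1 - q) * n) = 2 ^ (n : ℝ) / 2 ^ ((n : ℝ) * q) := by
        rw [← Real.rpow_sub (by norm_num)]; ring_nf
      have e3 : (2 : ℝ) ^ ((n + 1 : ℕ) : ℝ) = 2 ^ (n : ℝ) * 2 := by
        push_cast; rw [Real.rpow_add (by norm_num), Real.rpow_one]
      have h4 : (0 : ℝ) < 2 ^ (n : ℝ) := by positivity
      have h5 : (0 : ℝ) < 2 ^ ((n : ℝ) * q) := by positivity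
      rw [e2, e3, ← mul_div_assoc, e1]
      field_simp
    · by_cases h : a ≤ k w
      · left; rw [if_pos h]
      -- Points with `k w = 0` lie in no slice, but the integrand vanishes there.
      rcases (hk0 w).eq_or_lt with h0 | h0
      · left; rw [if_neg h, ← h0, Real.zero_rpow (by linarith), mul_zero]
      · right
        push Not at h
        obtain ⟨n, h1, h2⟩ := dyadic (a / k w) ((one_le_div h0).2 h.le)
        refine ⟨n, ?_, ?_⟩
        · rw [div_le_iff₀ (by positivity)]
          have := (div_lt_iff₀ h0).1 h2
          linarith
        · rw [if_neg (not_le.2 h)]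
          refine mul_le_mul_of_nonneg_left (Real.rpow_le_rpow (hk0 w) ?_ (by linarith)) (by positivity)
          rw [le_div_iff₀ (by positivity)]
          have := (le_div_iff₀ h0).1 h1
          linarith
  have hm : Measurable fun w => ENNReal.ofReal (if a ≤ k w then a ^ (2 - p) * k w ^ p else 0) := by
    refine (Measurable.ite (measurableSet_le measurable_const hk) ?_ measurable_const).ennreal_ofReal
    exact (hk.pow_const p).const_mul _
  calc ∫⁻ w, ENNReal.ofReal (splitMonomial p q a (k w)) ∂μ
      ≤ ∫⁻ w, (ENNReal.ofReal (if a ≤ k w then a ^ (2 - p) * k w ^ p else 0)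
        + ENNReal.ofReal (if a ≤ k w then 0 else a ^ (2 - q) * k w ^ q)) ∂μ := by
        refine lintegral_mono fun w => ?_
        unfold splitMonomial
        split_ifs <;> simp
    _ ≤ _ := by
        rw [lintegral_add_left hm]
        refine (add_le_add hlow hhigh).trans (le_of_eq ?_)
        rw [← ENNReal.ofReal_add (by positivity) (by positivity)]
        congr 1
        ring

/-- The weak Young inequality on a group for a symmetric kernel, in the normalized form. -/
theorem lintegral_rpow_mul_rpow_mul_kernel_le {G : Type*} [Group G] [MeasurableSpace G]
    [MeasurableMul₂ G] [MeasurableInv G] {μ : Measure G} [SFinite μ] [μ.IsMulLeftInvariant]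
    {k : G → ℝ} (hk : Measurable k) (hk0 : ∀ w, 0 ≤ k w) (hkinv : ∀ w, k w⁻¹ = k w)
    {c : ℝ} (hc : 0 ≤ c) (hμ : ∀ t, 0 < t → μ {w | t ≤ k w} ≤ ENNReal.ofReal (c / t))
    {α β κ : ℝ} (hα0 : 0 < α) (hα : α < 1) (hβ0 : 0 < β) (hβ : β < 1) (hκ0 : 0 < κ) (hκ : κ < 1)
    (hsum : α + β + κ = 2) :
    ∃ C : ℝ, 0 < C ∧ ∀ a b : G → ℝ, (∀ x, 0 ≤ a x) → (∀ x, 0 ≤ b x) → AEMeasurable a μ →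
      AEMeasurable b μ → ∫⁻ x, ENNReal.ofReal (a x) ∂μ ≤ 1 → ∫⁻ x, ENNReal.ofReal (b x) ∂μ ≤ 1 →
      ∫⁻ z, ENNReal.ofReal (a z.1 ^ α * b z.2 ^ β * k (z.1⁻¹ * z.2) ^ κ) ∂(μ.prod μ)
        ≤ ENNReal.ofReal C := by
  -- For fixed `x`, left invariance turns the integral over `y` into one over `w = x⁻¹ * y`. It is
  -- at most `C * a x`, and the weight has integral at most one.
  have split : ∀ q : ℝ, 1 < q → ∃ C : ℝ, 0 ≤ C ∧ ∀ a : G → ℝ, (∀ x, 0 ≤ a x) → AEMeasurable a μ →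
      ∫⁻ x, ENNReal.ofReal (a x) ∂μ ≤ 1 →
      AEMeasurable (fun z : G × G =>
        ENNReal.ofReal (splitMonomial κ q (a z.1) (k (z.1⁻¹ * z.2)))) (μ.prod μ) ∧
      ∫⁻ z, ENNReal.ofReal (splitMonomial κ q (a z.1) (k (z.1⁻¹ * z.2))) ∂(μ.prod μ)
        ≤ ENNReal.ofReal C := by
    intro q hq
    obtain ⟨C, hC, h⟩ := lintegral_splitMonomial_le hk hk0 hc hμ hκ0 hκ hq
    refine ⟨C, hC, fun a ha ham hint => ?_⟩
    have hmeas : AEMeasurable (fun z : G × G =>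
        ENNReal.ofReal (splitMonomial κ q (a z.1) (k (z.1⁻¹ * z.2)))) (μ.prod μ) := by
      have h1 : Measurable fun y : ℝ × ℝ => splitMonomial κ q y.1 y.2 :=
        Measurable.ite (measurableSet_le measurable_fst measurable_snd)
          ((measurable_fst.pow_const _).mul (measurable_snd.pow_const _))
          ((measurable_fst.pow_const _).mul (measurable_snd.pow_const _))
      have h2 : AEMeasurable (fun z : G × G => (a z.1, k (z.1⁻¹ * z.2))) (μ.prod μ) :=
        (ham.comp_quasiMeasurePreserving quasiMeasurePreserving_fst).prodMk
          (hk.comp (measurable_fst.inv.mul measurable_snd)).aemeasurable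
      exact (h1.comp_aemeasurable h2).ennreal_ofReal
    refine ⟨hmeas, ?_⟩
    rw [lintegral_prod _ hmeas]
    calc ∫⁻ x, ∫⁻ y, ENNReal.ofReal (splitMonomial κ q (a x) (k (x⁻¹ * y))) ∂μ ∂μ
        ≤ ∫⁻ x, ENNReal.ofReal C * ENNReal.ofReal (a x) ∂μ := by
          refine lintegral_mono fun x => ?_
          rw [lintegral_mul_left_eq_self
            (fun w => ENNReal.ofReal (splitMonomial κ q (a x) (k w))) x⁻¹, ← ENNReal.ofReal_mul hC]
          exact h _ (ha x)
      _ ≤ ENNReal.ofReal C := by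
          rw [lintegral_const_mul' _ _ ENNReal.ofReal_ne_top]
          exact mul_le_of_le_one_right zero_le hint
  -- As the exponents have sum 2, `κ / (1 - β) > 1` amounts to `α < 1`, and in the next line `κ / (1
  -- - α) > 1` to `β < 1`.
  obtain ⟨C₁, hC₁, h₁⟩ := split (κ / (1 - β)) (by rw [lt_div_iff₀ (by linarith)]; linarith)
  obtain ⟨C₂, hC₂, h₂⟩ := split (κ / (1 - α)) (by rw [lt_div_iff₀ (by linarith)]; linarith)
  refine ⟨1 + C₁ + C₂, by positivity, fun a b ha hb ham hbm hia hib => ?_⟩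
  obtain ⟨hm1, hi1⟩ := h₁ a ha ham hia
  obtain ⟨hm2, hi2⟩ := h₂ b hb hbm hib
  -- The weight `b` sits at the second point. Symmetry of `k` under inversion allows the two points
  -- to be exchanged, so that left invariance is enough here too.
  have hswap : (fun z : G × G => ENNReal.ofReal (splitMonomial κ (κ / (1 - α)) (b z.2)
      (k (z.1⁻¹ * z.2)))) = (fun z : G × G => ENNReal.ofReal (splitMonomial κ (κ / (1 - α)) (b z.1)
      (k (z.1⁻¹ * z.2)))) ∘ Prod.swap := by
    funext z
    simp only [Function.comp_apply, Prod.fst_swap, Prod.snd_swap]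
    rw [← hkinv (z.2⁻¹ * z.1), mul_inv_rev, inv_inv]
  have hi2' : ∫⁻ z, ENNReal.ofReal (splitMonomial κ (κ / (1 - α)) (b z.2) (k (z.1⁻¹ * z.2)))
      ∂(μ.prod μ) ≤ ENNReal.ofReal C₂ := by
    rw [hswap]
    exact (lintegral_prod_swap _).le.trans hi2
  calc ∫⁻ z, ENNReal.ofReal (a z.1 ^ α * b z.2 ^ β * k (z.1⁻¹ * z.2) ^ κ) ∂(μ.prod μ)
      ≤ ∫⁻ z, ((ENNReal.ofReal (a z.1) * ENNReal.ofReal (b z.2)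
        + ENNReal.ofReal (splitMonomial κ (κ / (1 - β)) (a z.1) (k (z.1⁻¹ * z.2))))
        + ENNReal.ofReal (splitMonomial κ (κ / (1 - α)) (b z.2) (k (z.1⁻¹ * z.2)))) ∂(μ.prod μ) := by
        refine lintegral_mono fun z => ?_
        rw [← ENNReal.ofReal_mul (ha _), ← ENNReal.ofReal_add (mul_nonneg (ha _) (hb _))
          (splitMonomial_nonneg (ha _) (hk0 _)), ← ENNReal.ofReal_add (add_nonneg
          (mul_nonneg (ha _) (hb _)) (splitMonomial_nonneg (ha _) (hk0 _)))
          (splitMonomial_nonneg (hb _) (hk0 _))]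
        exact ENNReal.ofReal_le_ofReal
          (rpow_mul_rpow_mul_rpow_le hα0 hα hβ0 hβ hκ0 hsum (ha _) (hb _) (hk0 _))
    _ ≤ 1 + ENNReal.ofReal C₁ + ENNReal.ofReal C₂ := by
        have hmab : AEMeasurable (fun z : G × G => ENNReal.ofReal (a z.1) * ENNReal.ofReal (b z.2))
            (μ.prod μ) :=
          (ham.comp_quasiMeasurePreserving quasiMeasurePreserving_fst).ennreal_ofReal.mul
            (hbm.comp_quasiMeasurePreserving quasiMeasurePreserving_snd).ennreal_ofReal
        rw [lintegral_add_left' (f := fun z : G × G => ENNReal.ofReal (a z.1) * ENNReal.ofReal (b z.2)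
          + ENNReal.ofReal (splitMonomial κ (κ / (1 - β)) (a z.1) (k (z.1⁻¹ * z.2)))) (hmab.add hm1),
          lintegral_add_left' hmab]
        refine add_le_add (add_le_add ?_ hi1) hi2'
        rw [lintegral_prod_mul ham.ennreal_ofReal hbm.ennreal_ofReal]
        exact mul_le_one' hia hib
    _ = _ := by
        rw [ENNReal.ofReal_add (by positivity) hC₂, ENNReal.ofReal_add zero_le_one hC₁,
          ENNReal.ofReal_one]

/-! ### Invariance of product measures under triangular maps. -/

/-- A triangular map of a product, whose components are translations by amounts that depend on the
previous coordinates only, preserves a product of invariant measures. -/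
theorem measurePreserving_pi_of_triangular {n : ℕ} {α : Fin n → Type*} [∀ i, AddCommGroup (α i)]
    [∀ i, MeasurableSpace (α i)] [∀ i, MeasurableAdd (α i)] (μ : ∀ i, Measure (α i))
    [∀ i, SigmaFinite (μ i)] [∀ i, (μ i).IsAddLeftInvariant] {T : (∀ i, α i) → ∀ i, α i}
    (hT : Measurable T)
    (htri : ∀ l u v, (∀ i < l, u i = v i) → T u l - u l = T v l - v l) :
    MeasurePreserving T (Measure.pi μ) (Measure.pi μ) := by
  induction n with
  | zero =>
    have : T = id := funext fun u => Subsingleton.elim _ _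
    rw [this]; exact MeasurePreserving.id _
  | succ n ih =>
    let e := MeasurableEquiv.piFinSuccAbove α 0
    have he := measurePreserving_piFinSuccAbove μ 0
    have e0 : ∀ p, e.symm p 0 = p.1 := fun p => Fin.insertNth_apply_same 0 p.1 p.2
    have es : ∀ p j, e.symm p (Fin.succAbove 0 j) = p.2 j := fun p j =>
      Fin.insertNth_apply_succAbove 0 p.1 p.2 j
    let c := T 0 0
    -- No coordinate precedes the first one, so its translation amount is a constant.
    have hfirst : ∀ p, T (e.symm p) 0 = c + p.1 := by
      intro p
      have := htri 0 (e.symm p) 0 fun i hi => absurd hi (Fin.not_lt_zero i)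
      rw [e0, Pi.zero_apply, sub_zero] at this
      exact sub_eq_iff_eq_add.1 this
    let g : α 0 → (∀ j, α (Fin.succAbove 0 j)) → ∀ j, α (Fin.succAbove 0 j) :=
      fun a w => (e (T (e.symm (a, w)))).2
    have hg : Measurable (Function.uncurry g) :=
      measurable_snd.comp (e.measurable.comp (hT.comp e.symm.measurable))
    -- With the first coordinate frozen, the remaining map is again triangular, in one variable
    -- fewer; the skew product theorem assembles these fibre maps.
    have key := (measurePreserving_add_left (μ 0) c).skew_product (g := g) hg
      (μc := Measure.pi fun j => μ (Fin.succAbove 0 j))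
      (μd := Measure.pi fun j => μ (Fin.succAbove 0 j)) (Filter.Eventually.of_forall fun a => by
        refine (ih _ (T := g a) (hg.comp measurable_prodMk_left) fun l u v huv => ?_).map_eq
        have := htri (Fin.succAbove 0 l) (e.symm (a, u)) (e.symm (a, v)) fun i hi => by
          rcases Fin.eq_self_or_eq_succAbove 0 i with rfl | ⟨j, rfl⟩
          · rw [e0, e0]
          · rw [es, es]
            exact huv j ((Fin.succAbove_lt_succAbove_iff).1 hi)
        rwa [es, es] at this)
    have hTe : T = e.symm ∘ (fun p => (c + p.1, g p.1 p.2)) ∘ e := by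
      funext u
      apply e.injective
      simp only [Function.comp_apply, MeasurableEquiv.apply_symm_apply]
      refine Prod.ext ?_ ?_
      · have := hfirst (e u)
        rw [e.symm_apply_apply] at this
        exact this
      · simp only [g, Prod.mk.eta, e.symm_apply_apply]
    rw [hTe]
    exact (he.symm e).comp (key.comp he)

/-! ### Triangularity of the Baker-Campbell-Hausdorff product along the layers. -/

namespace Carnot
namespace Stratification
variable {L : Type*} [LieRing L] [LieAlgebra ℝ L] {r : ℕ} (S : Stratification L r)

theorem tail_mono {i j : ℕ} (h : i ≤ j) : S.tail j ≤ S.tail i :=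
  iSup_le fun k => S.gr_le_tail (h.trans k.2)

theorem toLie_mem_tail {u : CarnotGroup S} {l : ℕ} (hu : ∀ i : Fin r, (i : ℕ) < l → u i = 0) :
    S.toLie u ∈ S.tail (l + 1) := by
  refine Submodule.sum_mem _ fun i _ => Submodule.sum_mem _ fun j _ => ?_
  by_cases hi : (i : ℕ) < l
  · rw [hu i hi]; simp
  · refine Submodule.smul_mem _ _ (S.gr_le_tail (j := i + 1) (by omega) ?_)
    rw [S.gr_eq (by omega) (by omega)]
    exact (S.basis i j).2

theorem repr_eq_zero_of_mem_tail {l : ℕ} {x : L} (hx : x ∈ S.tail l)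
    (i : Σ l : Fin r, Fin (S.m l)) (hi : (i.1 : ℕ) + 1 < l) : S.fullBasis.repr x i = 0 := by
  suffices S.tail l ≤ LinearMap.ker (S.fullBasis.coord i) from this hx
  refine iSup_le fun k => ?_
  intro x hx
  have hk := k.2
  by_cases h : 1 ≤ (k : ℕ) ∧ (k : ℕ) ≤ r
  · rw [S.gr_eq h.1 h.2] at hx
    obtain ⟨k, hk'⟩ := k
    obtain ⟨m, rfl⟩ : ∃ m : Fin r, k = m + 1 := ⟨⟨k - 1, by simp only at h; omega⟩, by simp only at h ⊢; omega⟩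
    have e : S.fullBasis.coord i ∘ₗ (S.layer (m + 1)).subtype = 0 := by
      refine (S.basis m).ext fun j => ?_
      have hb : (S.basis m j : L) = S.fullBasis ⟨m, j⟩ := by simp [fullBasis]
      simp only [LinearMap.comp_apply, Submodule.subtype_apply, hb, Module.Basis.coord_apply,
        Module.Basis.repr_self, LinearMap.zero_apply]
      refine Finsupp.single_eq_of_ne fun h' => ?_
      subst h'
      simp only at hi hk
      omega
    exact LinearMap.congr_fun e ⟨x, hx⟩
  · rw [gr, if_neg h, Submodule.mem_bot] at hx
    rw [hx]; exact zero_mem _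

/-- Every bracket raises the filtration degree by at least one, so changing a letter modulo `tail l`
changes a genuine bracket only modulo `tail (l + 1)`. A single letter gains nothing; the weaker
first claim is what the recursion needs when the rest of the word is one letter. -/
theorem nestedBracket_sub_mem_tail (x y y' : L) {l : ℕ} (hl : 1 ≤ l) (h : y - y' ∈ S.tail l) :
    ∀ w : List Bool, nestedBracket (w.map fun b => cond b x y)
        - nestedBracket (w.map fun b => cond b x y') ∈ S.tail l ∧
      (2 ≤ w.length → nestedBracket (w.map fun b => cond b x y)
        - nestedBracket (w.map fun b => cond b x y') ∈ S.tail (l + 1))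
  | [] => by simp [nestedBracket]
  | [b] => by
    refine ⟨?_, fun h => by simp at h⟩
    cases b
    · exact h
    · simp [nestedBracket]
  | b :: b' :: w => by
    have ih := (nestedBracket_sub_mem_tail x y y' hl h (b' :: w)).1
    have hb : cond b x y - cond b x y' ∈ S.tail l := by
      cases b
      · exact h
      · simp
    suffices nestedBracket ((b :: b' :: w).map fun b => cond b x y)
        - nestedBracket ((b :: b' :: w).map fun b => cond b x y') ∈ S.tail (l + 1) from
      ⟨S.tail_mono (Nat.le_succ l) this, fun _ => this⟩
    simp only [List.map_cons, nestedBracket] at ih ⊢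
    set N := nestedBracket (cond b' x y :: w.map fun b => cond b x y)
    set N' := nestedBracket (cond b' x y' :: w.map fun b => cond b x y')
    -- Change the inner bracket and the outer letter separately, with the small difference always on
    -- the right, as `lie_tail` requires.
    have e : ⁅cond b x y, N⁆ - ⁅cond b x y', N'⁆
        = ⁅cond b x y', N - N'⁆ - ⁅N, cond b x y - cond b x y'⁆ := by
      rw [lie_sub, lie_sub, ← lie_skew N, ← lie_skew N]
      abel
    rw [e]
    exact sub_mem (S.lie_tail hl _ ih) (S.lie_tail hl _ hb)

/-- The part of the displacement `bch r x y - y` in layer `l` depends only on the layers of `y`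
below `l`. Indeed the one-letter words of the series are `x`, which does not change, and `y`, which
is subtracted; all other terms are genuine brackets and gain one degree. -/
theorem bch_sub_sub_mem_tail (hr : 1 ≤ r) (x y y' : L) {l : ℕ} (hl : 1 ≤ l) (h : y - y' ∈ S.tail l) :
    (bch r x y - y) - (bch r x y' - y') ∈ S.tail (l + 1) := by
  have hw : ∀ z : L, ∀ {n : ℕ} (p q : Fin n → ℕ), bchWord x z p q
      = (bchWord true false p q).map fun b => cond b x z := fun z n p q => by
    rw [← bchWord_map]; rfl
  let t : L → ∀ n : ℕ, (Fin n → Fin (r + 1)) → (Fin n → Fin (r + 1)) → L := fun z n p q =>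
    if ∀ i, 0 < (p i : ℕ) + q i then
      ((-1 : ℝ) ^ (n - 1) / n * (∑ i, ((p i : ℝ) + q i))⁻¹ *
        ∏ i, (((p i).val.factorial : ℝ) * (q i).val.factorial)⁻¹) •
        nestedBracket (bchWord x z (fun i => p i) (fun i => q i))
    else 0
  have ht : ∀ z, bch r x z = ∑ n ∈ Finset.Icc 1 r, ∑ p, ∑ q, t z n p q := fun z => rfl
  -- The word consisting of the second letter alone occurs once, with the coefficient one.
  let d : ∀ n : ℕ, (Fin n → Fin (r + 1)) → (Fin n → Fin (r + 1)) → L := fun n p q =>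
    if n = 1 ∧ (∀ i, (p i : ℕ) = 0) ∧ ∀ i, (q i : ℕ) = 1 then y - y' else 0
  have hd : ∑ n ∈ Finset.Icc 1 r, ∑ p, ∑ q, d n p q = y - y' := by
    have h1 : ((⟨1, by omega⟩ : Fin (r + 1)) : ℕ) = 1 := rfl
    rw [Finset.sum_eq_single 1, Finset.sum_eq_single (fun _ => ⟨0, by omega⟩),
      Finset.sum_eq_single (fun _ => ⟨1, by omega⟩)]
    · simp [d]
    · intro q _ hq
      refine if_neg fun h' => hq (funext fun i => Fin.ext (h'.2.2 i))
    · simp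
    · intro p _ hp
      exact Finset.sum_eq_zero fun q _ =>
        if_neg fun h' => hp (funext fun i => Fin.ext (h'.2.1 i))
    · simp
    · intro n _ hn
      exact Finset.sum_eq_zero fun p _ => Finset.sum_eq_zero fun q _ => if_neg fun h' => hn h'.1
    · intro h'
      simp only [Finset.mem_Icc, le_refl, true_and, not_le] at h'
      omega
  have key : ∀ n ∈ Finset.Icc 1 r, ∀ p q, t y n p q - t y' n p q - d n p q ∈ S.tail (l + 1) := by
    intro n hn p q
    rw [Finset.mem_Icc] at hn
    by_cases hpq : ∀ i, 0 < (p i : ℕ) + q i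
    · have hlen : n ≤ ∑ i, ((p i : ℕ) + q i) := by
        calc n = ∑ i : Fin n, 1 := by simp
          _ ≤ _ := Finset.sum_le_sum fun i _ => hpq i
      simp only [t, if_pos hpq]
      rw [← smul_sub]
      -- Words with at least two letters gain a degree. Otherwise `n = 1` and the word is `y`, where
      -- `d` cancels the difference, or `x`, where there is none.
      rcases Nat.lt_or_ge 1 (∑ i, ((p i : ℕ) + q i)) with h2 | h2
      · have hd0 : d n p q = 0 := by
          refine if_neg ?_
          rintro ⟨rfl, hp, hq⟩
          simp [hp, hq] at h2
        rw [hd0, sub_zero, hw y, hw y']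
        refine Submodule.smul_mem _ _ ((S.nestedBracket_sub_mem_tail x y y' hl h _).2 ?_)
        rw [length_bchWord]
        exact h2
      · obtain rfl : n = 1 := by omega
        simp only [Fin.sum_univ_one] at hlen h2
        have hcase : ((p 0 : ℕ) = 0 ∧ (q 0 : ℕ) = 1) ∨ ((p 0 : ℕ) = 1 ∧ (q 0 : ℕ) = 0) := by omega
        rcases hcase with ⟨hp, hq⟩ | ⟨hp, hq⟩
        · have hp' : p 0 = 0 := Fin.ext hp
          simp [d, bchWord, nestedBracket, hp', hq]
        · simp [d, bchWord, nestedBracket, hp, hq]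
    · have hd0 : d n p q = 0 := by
        refine if_neg fun h' => hpq fun i => ?_
        have := h'.2.2 i
        omega
      simp only [t, if_neg hpq, hd0, sub_self]
      exact zero_mem _
  have e : (bch r x y - y) - (bch r x y' - y')
      = ∑ n ∈ Finset.Icc 1 r, ∑ p, ∑ q, (t y n p q - t y' n p q - d n p q) := by
    simp only [Finset.sum_sub_distrib]
    rw [← ht, ← ht, hd]
    abel
  rw [e]
  exact Submodule.sum_mem _ fun n hn => Submodule.sum_mem _ fun p _ => Submodule.sum_mem _ fun q _ =>
    key n hn p q

/-! ### Lebesgue measure as a Haar measure -/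

/-- Lebesgue measure in exponential coordinates. -/
noncomputable def lebesgue : Measure (CarnotGroup S) :=
  Measure.pi fun l : Fin r => (volume : Measure (EuclideanSpace ℝ (Fin (S.m l))))

instance : SecondCountableTopology (CarnotGroup S) :=
  inferInstanceAs (SecondCountableTopology (∀ l : Fin r, EuclideanSpace ℝ (Fin (S.m l))))
instance : LocallyCompactSpace (CarnotGroup S) :=
  inferInstanceAs (LocallyCompactSpace (∀ l : Fin r, EuclideanSpace ℝ (Fin (S.m l))))
instance : IsFiniteMeasureOnCompacts S.lebesgue :=
  inferInstanceAs (IsFiniteMeasureOnCompacts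
    (Measure.pi fun l : Fin r => (volume : Measure (EuclideanSpace ℝ (Fin (S.m l))))))
instance : IsOpenPosMeasure S.lebesgue :=
  inferInstanceAs (IsOpenPosMeasure
    (Measure.pi fun l : Fin r => (volume : Measure (EuclideanSpace ℝ (Fin (S.m l))))))

theorem toLie_apply_repr (u : CarnotGroup S) (l : Fin r) (j : Fin (S.m l)) :
    S.fullBasis.repr (S.toLie u) ⟨l, j⟩ = u l j := by
  conv_rhs => rw [← S.ofLie_toLie u]
  rfl

/-- This is the triangularity hypothesis of `measurePreserving_pi_of_triangular` for left
translations. The index `l` stands for layer `l + 1`: agreement before `l` places the difference in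
`tail (l + 1)`, the displacements then agree modulo `tail (l + 2)`, and the coordinates of index `l`
do not see that tail. -/
theorem mul_apply_sub_apply (g : CarnotGroup S) (l : Fin r) (u v : CarnotGroup S)
    (h : ∀ i < l, u i = v i) : (g * u) l - u l = (g * v) l - v l := by
  have huv : S.toLie u - S.toLie v ∈ S.tail (l + 1) := by
    have e : S.toLie u - S.toLie v = S.toLie (fun i => u i - v i) := by
      simp [toLie, sub_smul]
    rw [e]
    exact S.toLie_mem_tail fun i hi => by rw [h i hi, sub_self]
  have hr : 1 ≤ r := by have := l.2; omega
  have := S.bch_sub_sub_mem_tail hr (S.toLie g) _ _ (by omega) huv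
  rw [← toLie_mul, ← toLie_mul] at this
  ext j
  have h0 := S.repr_eq_zero_of_mem_tail this ⟨l, j⟩ (by simp)
  simp only [map_sub, Finsupp.sub_apply, toLie_apply_repr] at h0
  simp only [PiLp.sub_apply]
  exact sub_eq_zero.1 h0

instance : IsHaarMeasure S.lebesgue where
  lt_top_of_isCompact _ hK := hK.measure_lt_top
  open_pos := IsOpenPosMeasure.open_pos
  map_mul_left_eq_self g :=
    (measurePreserving_pi_of_triangular
      (fun l : Fin r => (volume : Measure (EuclideanSpace ℝ (Fin (S.m l)))))
      (T := fun u : CarnotGroup S => g * u) (continuous_const_mul g).measurable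
      (S.mul_apply_sub_apply g)).map_eq

/-! ### The homogeneous norm -/

theorem homNorm_nonneg (u : CarnotGroup S) : 0 ≤ S.homNorm u := by
  unfold homNorm; positivity

theorem homNorm_inv (u : CarnotGroup S) : S.homNorm u⁻¹ = S.homNorm u := by
  have : ∀ l, ‖u⁻¹ l‖ = ‖u l‖ := fun l => norm_neg (u l)
  simp only [homNorm, this]

theorem measurable_homNorm : Measurable S.homNorm := by
  refine Measurable.pow_const (Finset.measurable_sum _ fun l _ => Measurable.pow_const ?_ _) _
  exact (measurable_pi_apply (X := fun l : Fin r => EuclideanSpace ℝ (Fin (S.m l))) l).norm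

theorem norm_le_of_homNorm_le {u : CarnotGroup S} {R : ℝ} (h : S.homNorm u ≤ R) (l : Fin r) :
    ‖u l‖ ≤ R ^ ((l : ℕ) + 1) := by
  have hR : 0 ≤ R := (S.homNorm_nonneg u).trans h
  have hf : (0 : ℝ) < 2 * r.factorial := by positivity
  have hl : (0 : ℝ) < (l : ℝ) + 1 := by positivity
  have h1 : ‖u l‖ ^ (2 * (r.factorial : ℝ) / ((l : ℝ) + 1)) ≤ R ^ (2 * (r.factorial : ℝ)) := by
    refine (Finset.single_le_sum (f := fun l : Fin r => ‖u l‖ ^ (2 * (r.factorial : ℝ) / ((l : ℝ) + 1)))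
      (fun i _ => by positivity) (Finset.mem_univ l)).trans ?_
    have := Real.rpow_le_rpow (S.homNorm_nonneg u) h hf.le
    rwa [homNorm, ← Real.rpow_mul (by positivity), one_div, inv_mul_cancel₀ hf.ne', Real.rpow_one]
      at this
  have h2 := Real.rpow_le_rpow (by positivity) h1 (z := ((l : ℝ) + 1) / (2 * r.factorial)) (by positivity)
  rw [← Real.rpow_mul (norm_nonneg _), ← Real.rpow_mul hR, div_mul_div_cancel₀ hl.ne',
    div_self hf.ne', Real.rpow_one, mul_div_cancel₀ _ hf.ne'] at h2
  rw [← Real.rpow_natCast]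
  push_cast
  exact h2

/-- Only an upper bound is needed, so the ball may be enlarged to a product of Euclidean balls of
radius `R ^ j` in layer `j`. Their volumes scale like `R ^ (j * mⱼ)`, and the exponents add up to
`Q`. -/
theorem lebesgue_homNorm_le : ∃ c : ℝ, 0 ≤ c ∧ ∀ R : ℝ, 0 ≤ R →
    S.lebesgue {u | S.homNorm u ≤ R} ≤ ENNReal.ofReal (c * R ^ S.homDim) := by
  refine ⟨∏ l : Fin r, (volume : Measure (EuclideanSpace ℝ (Fin (S.m l)))).real
    (Metric.closedBall 0 1), by positivity, fun R hR => ?_⟩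
  calc S.lebesgue {u | S.homNorm u ≤ R}
      ≤ S.lebesgue (Set.univ.pi fun l : Fin r =>
          Metric.closedBall (0 : EuclideanSpace ℝ (Fin (S.m l))) (R ^ ((l : ℕ) + 1))) := by
        refine measure_mono fun u hu l _ => ?_
        rw [mem_closedBall_zero_iff]
        exact S.norm_le_of_homNorm_le hu l
    _ = ∏ l : Fin r, volume
          (Metric.closedBall (0 : EuclideanSpace ℝ (Fin (S.m l))) (R ^ ((l : ℕ) + 1))) :=
        Measure.pi_pi _ _
    _ = ∏ l : Fin r, ENNReal.ofReal (R ^ (((l : ℕ) + 1) * S.m l) *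
          (volume : Measure (EuclideanSpace ℝ (Fin (S.m l)))).real (Metric.closedBall 0 1)) := by
        refine Finset.prod_congr rfl fun l _ => ?_
        rw [addHaar_closedBall' _ _ (by positivity), finrank_euclideanSpace_fin, ← pow_mul,
          ENNReal.ofReal_mul (by positivity), ofReal_measureReal
            (isCompact_closedBall _ _).measure_lt_top.ne]
    _ = _ := by
        rw [← ENNReal.ofReal_prod_of_nonneg fun _ _ => by positivity, Finset.prod_mul_distrib,
          Finset.prod_pow_eq_pow_sum, homDim, mul_comm]

theorem haar_homNorm_le (μ : Measure (CarnotGroup S)) [μ.IsHaarMeasure] :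
    ∃ c : ℝ, 0 ≤ c ∧ ∀ R : ℝ, 0 ≤ R →
      μ {u | S.homNorm u ≤ R} ≤ ENNReal.ofReal (c * R ^ S.homDim) := by
  obtain ⟨c, hc, h⟩ := S.lebesgue_homNorm_le
  refine ⟨haarScalarFactor μ S.lebesgue * c, by positivity, fun R hR => ?_⟩
  have e : μ {u | S.homNorm u ≤ R}
      = haarScalarFactor μ S.lebesgue * S.lebesgue {u | S.homNorm u ≤ R} :=
    congrArg (fun ν : Measure (CarnotGroup S) => ν {u | S.homNorm u ≤ R})
      (isMulLeftInvariant_eq_smul μ S.lebesgue)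
  rw [e, mul_assoc, ENNReal.ofReal_mul (by positivity), ENNReal.ofReal_coe_nnreal]
  exact mul_le_mul_right (h R hR) _

/-- The kernel `|w| ^ (-Q)` is in weak `L¹`. -/
theorem haar_le_homNorm_rpow_neg (μ : Measure (CarnotGroup S)) [μ.IsHaarMeasure]
    (hQ : 0 < S.homDim) :
    ∃ c : ℝ, 0 ≤ c ∧ ∀ t : ℝ, 0 < t →
      μ {u | t ≤ S.homNorm u ^ (-(S.homDim : ℝ))} ≤ ENNReal.ofReal (c / t) := by
  obtain ⟨c, hc, h⟩ := S.haar_homNorm_le μ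
  have hQ' : (0 : ℝ) < S.homDim := by exact_mod_cast hQ
  refine ⟨c, hc, fun t ht => ?_⟩
  -- The superlevel set of the kernel at height `t` lies in the ball of radius `t ^ (-1 / Q)`.
  have hR : (t⁻¹ ^ ((S.homDim : ℝ)⁻¹)) ^ S.homDim = t⁻¹ :=
    Real.rpow_inv_natCast_pow (by positivity) hQ.ne'
  refine (measure_mono fun u hu => ?_).trans
    ((h (t⁻¹ ^ ((S.homDim : ℝ)⁻¹)) (by positivity)).trans (by rw [hR, div_eq_mul_inv]))
  have hu : t ≤ S.homNorm u ^ (-(S.homDim : ℝ)) := hu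
  change S.homNorm u ≤ _
  rw [Real.rpow_neg (S.homNorm_nonneg u)] at hu
  rw [← Real.rpow_le_rpow_iff (S.homNorm_nonneg u) (by positivity) hQ',
    ← Real.rpow_mul (by positivity), inv_mul_cancel₀ hQ'.ne', Real.rpow_one]
  exact le_inv_of_le_inv₀ ht hu

end Stratification
end Carnot

/-! ### Normalization of the two functions and conclusion. -/

/-- An `L^r` function is, up to its norm, the `1 / r`-th power of a weight of integral at most one. -/
theorem MeasureTheory.MemLp.exists_weight {G : Type*} [MeasurableSpace G] {μ : Measure G} {r : ℝ}
    (hr : 0 < r) {f : G → ℂ} (hf : MemLp f (ENNReal.ofReal r) μ) :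
    ∃ a : G → ℝ, (∀ x, 0 ≤ a x) ∧ AEMeasurable a μ ∧ ∫⁻ x, ENNReal.ofReal (a x) ∂μ ≤ 1 ∧
      ∀ᵐ x ∂μ, ‖f x‖ = (∫ u, ‖f u‖ ^ r ∂μ) ^ (1 / r) * a x ^ (1 / r) := by
  have hint : Integrable (fun x => ‖f x‖ ^ r) μ := by
    have := hf.integrable_norm_rpow (ENNReal.ofReal_pos.2 hr).ne' ENNReal.ofReal_ne_top
    rwa [ENNReal.toReal_ofReal hr.le] at this
  have hA : 0 ≤ ∫ u, ‖f u‖ ^ r ∂μ := integral_nonneg fun _ => by positivity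
  set A := ∫ u, ‖f u‖ ^ r ∂μ with hAdef
  -- If `A = 0`, division by zero makes the weight zero; this is harmless, since then `f = 0` almost
  -- everywhere.
  refine ⟨fun x => ‖f x‖ ^ r / A, fun x => by positivity, hint.aemeasurable.div_const _, ?_, ?_⟩
  · rw [← ofReal_integral_eq_lintegral_ofReal (hint.div_const A)
      (Filter.Eventually.of_forall fun x => by positivity), integral_div, ← hAdef]
    exact ENNReal.ofReal_le_one.2 (div_self_le_one A)
  · rcases hA.eq_or_lt with h0 | h0
    · have h := (integral_eq_zero_iff_of_nonneg (fun x => by positivity) hint).1 h0.symm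
      filter_upwards [h] with x hx
      rw [← h0, Real.zero_rpow (by positivity), zero_mul]
      exact (Real.rpow_eq_zero (norm_nonneg _) hr.ne').1 hx
    · refine Filter.Eventually.of_forall fun x => ?_
      rw [← Real.mul_rpow hA (by positivity), mul_div_cancel₀ _ h0.ne', ← Real.rpow_mul (by positivity),
        mul_one_div_cancel hr.ne', Real.rpow_one]

/-- The Hardy-Littlewood-Sobolev type inequality on Carnot groups. Here `du` is any fixed Haar
measure `μ`; the double integral converges absolutely, and the constant does not depend on
`f ∈ L^r`, `g ∈ L^s`. -/
theorem corollary2p3 {L : Type*} [LieRing L] [LieAlgebra ℝ L] {step : ℕ}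
    (S : Carnot.Stratification L step)
    (μ : MeasureTheory.Measure (Carnot.CarnotGroup S)) [μ.IsHaarMeasure]
    (r s lam : ℝ) (hr : 1 < r) (hs : 1 < s) (hlam : 0 < lam) (hlamQ : lam < S.homDim)
    (hrs : 1 / r + 1 / s + lam / S.homDim = 2) :
    ∃ C : ℝ, 0 < C ∧ ∀ f g : Carnot.CarnotGroup S → ℂ,
      MeasureTheory.MemLp f (ENNReal.ofReal r) μ →
      MeasureTheory.MemLp g (ENNReal.ofReal s) μ →
      MeasureTheory.Integrable
        (fun p : Carnot.CarnotGroup S × Carnot.CarnotGroup S =>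
          (starRingEnd ℂ (f p.1) * g p.2) / ((S.homNorm (p.1⁻¹ * p.2) ^ lam : ℝ) : ℂ))
        (μ.prod μ) ∧
      ‖∫ p : Carnot.CarnotGroup S × Carnot.CarnotGroup S,
          (starRingEnd ℂ (f p.1) * g p.2) / ((S.homNorm (p.1⁻¹ * p.2) ^ lam : ℝ) : ℂ)
          ∂(μ.prod μ)‖
        ≤ C * (∫ u, ‖f u‖ ^ r ∂μ) ^ (1 / r) * (∫ v, ‖g v‖ ^ s ∂μ) ^ (1 / s) := by
  have hQ : (0 : ℝ) < S.homDim := hlam.trans hlamQ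
  obtain ⟨c, hc, hμ⟩ := S.haar_le_homNorm_rpow_neg μ (by exact_mod_cast hQ)
  -- The hypothesis `hrs` is exactly the requirement that the three exponents have sum 2. The
  -- constant is fixed before `f` and `g` are introduced.
  obtain ⟨C, hC, H⟩ := lintegral_rpow_mul_rpow_mul_kernel_le (μ := μ)
    (k := fun w => S.homNorm w ^ (-(S.homDim : ℝ))) (S.measurable_homNorm.pow_const _)
    (fun w => Real.rpow_nonneg (S.homNorm_nonneg w) _) (fun w => by rw [S.homNorm_inv]) hc hμ
    (α := 1 / r) (β := 1 / s) (κ := lam / S.homDim) (by positivity)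
    ((div_lt_one (by linarith)).2 hr) (by positivity) ((div_lt_one (by linarith)).2 hs)
    (by positivity) ((div_lt_one hQ).2 hlamQ) hrs
  refine ⟨C, hC, fun f g hf hg => ?_⟩
  obtain ⟨a, ha, ham, hia, hfa⟩ := hf.exists_weight (by linarith)
  obtain ⟨b, hb, hbm, hib, hgb⟩ := hg.exists_weight (by linarith)
  have hA : 0 ≤ ∫ u, ‖f u‖ ^ r ∂μ := integral_nonneg fun _ => by positivity
  have hB : 0 ≤ ∫ v, ‖g v‖ ^ s ∂μ := integral_nonneg fun _ => by positivity
  set A := (∫ u, ‖f u‖ ^ r ∂μ) ^ (1 / r)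
  set B := (∫ v, ‖g v‖ ^ s ∂μ) ^ (1 / s)
  have hA' : 0 ≤ A := Real.rpow_nonneg hA _
  have hB' : 0 ≤ B := Real.rpow_nonneg hB _
  set F := fun p : Carnot.CarnotGroup S × Carnot.CarnotGroup S =>
    (starRingEnd ℂ (f p.1) * g p.2) / ((S.homNorm (p.1⁻¹ * p.2) ^ lam : ℝ) : ℂ)
  have hnorm : ∀ᵐ p ∂μ.prod μ, ‖F p‖ = A * B * (a p.1 ^ (1 / r) * b p.2 ^ (1 / s) *
      (S.homNorm (p.1⁻¹ * p.2) ^ (-(S.homDim : ℝ))) ^ (lam / S.homDim)) := by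
    filter_upwards [quasiMeasurePreserving_fst.ae hfa, quasiMeasurePreserving_snd.ae hgb]
      with p hp1 hp2
    have hN := S.homNorm_nonneg (p.1⁻¹ * p.2)
    -- This also covers the diagonal, where the norm is zero: the inverse of zero is zero, so both
    -- sides vanish there.
    rw [← Real.rpow_mul hN, neg_mul, mul_div_cancel₀ _ hQ.ne', Real.rpow_neg hN]
    simp only [F, norm_div, norm_mul, RCLike.norm_conj, Complex.norm_real, Real.norm_eq_abs]
    rw [hp1, hp2, abs_of_nonneg (Real.rpow_nonneg hN _)]
    ring
  have hFm : AEStronglyMeasurable F (μ.prod μ) := by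
    have h1 : AEMeasurable (fun p : Carnot.CarnotGroup S × Carnot.CarnotGroup S => f p.1)
        (μ.prod μ) :=
      hf.aestronglyMeasurable.aemeasurable.comp_quasiMeasurePreserving quasiMeasurePreserving_fst
    have h2 : AEMeasurable (fun p : Carnot.CarnotGroup S × Carnot.CarnotGroup S => g p.2)
        (μ.prod μ) :=
      hg.aestronglyMeasurable.aemeasurable.comp_quasiMeasurePreserving quasiMeasurePreserving_snd
    have h3 : Measurable fun p : Carnot.CarnotGroup S × Carnot.CarnotGroup S =>
        ((S.homNorm (p.1⁻¹ * p.2) ^ lam : ℝ) : ℂ) :=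
      Complex.measurable_ofReal.comp
        ((S.measurable_homNorm.comp (measurable_fst.inv.mul measurable_snd)).pow_const _)
    exact (((Complex.continuous_conj.measurable.comp_aemeasurable h1).mul h2).div
      h3.aemeasurable).aestronglyMeasurable
  -- This one bound on the integral of the absolute value yields both absolute convergence and the
  -- inequality.
  have hbound : ∫⁻ p, ENNReal.ofReal ‖F p‖ ∂(μ.prod μ) ≤ ENNReal.ofReal (C * A * B) := by
    rw [lintegral_congr_ae (hnorm.mono fun p hp => congrArg ENNReal.ofReal hp)]
    simp only [ENNReal.ofReal_mul (mul_nonneg hA' hB')]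
    rw [lintegral_const_mul' _ _ ENNReal.ofReal_ne_top,
      show C * A * B = A * B * C by ring, ENNReal.ofReal_mul (mul_nonneg hA' hB')]
    exact mul_le_mul_right (H a b ha hb ham hbm hia hib) _
  refine ⟨⟨hFm, ?_⟩, ?_⟩
  · rw [hasFiniteIntegral_iff_norm]
    exact hbound.trans_lt ENNReal.ofReal_lt_top
  · refine (norm_integral_le_lintegral_norm _).trans ?_
    exact ENNReal.toReal_le_of_le_ofReal (by positivity) hbound
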